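/- For a positive integer $n$ let $G_{n,p}$ be the random graph on the vertex set $[n]=\{1,\dots,n\}$ in which each of the $\binom n2$ possible edges is present independently with probability $p$. A Hamilton cycle $H$ of a graph on $[n]$ is regarded as the sequence $(i_1=1,i_2,\dots,i_n)$ of its vertices in the order in which they are visited starting from vertex $1$ (in either direction), and $\iota(H)=|\{(k,\ell):k<\ell,\ i_k>i_\ell\}|$ denotes its number of inversions. "W.h.p." means with probability tending to $1$ as $n\to\infty$. Theorem. There is an absolute constant $K>0$ with the following property. Let $M=M(n)$ be real numbers with $M=\Omega(n\log n)$, that is, for some constant $c>0$, $M(n)\ge c\,n\log n$ for all sufficiently large $n$. (a) If $M\le n^2$ for all sufficiently large $n$, and $p=p(n)\in[0,1]$ satisfies $p\ge \dfrac{Kn\log n}{M}$ for all sufficiently large $n$, then w.h.p. $G_{n,p}$ contains a Hamilton cycle $H$ with $\iota(H)\le M$. (b) If $\varepsilon>0$ is a constant and $p=p(n)\in[0,1]$ satisfies $p\le \dfrac{(1-\varepsilon)n}{eM}$ for all sufficiently large $n$, then w.h.p. $G_{n,p}$ contains no Hamilton cycle $H$ with $\iota(H)\le M$. -/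

import Mathlib

open Filter Topology

/-- The number of inversions of the vertex sequence of a closed walk `w` on `n` labelled vertices:
writing `i_k = w.getVert k` for `0 ≤ k < n` (for a Hamilton cycle these are the `n` vertices in
the order in which they are visited), the number of pairs `k < l` with `i_k > i_l`. -/
def SimpleGraph.Walk.inversions {n : ℕ} {G : SimpleGraph (Fin n)} {v : Fin n}
    (w : G.Walk v v) : ℕ :=
  (Finset.univ.filter
    (fun q : Fin n × Fin n => q.1 < q.2 ∧ w.getVert q.2.val < w.getVert q.1.val)).card

/-- `G` has a Hamilton cycle which, traversed from the smallest vertex (in one of its two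
directions), has at most `m` inversions. -/
def HasHamiltonCycleWithInversionsLE {n : ℕ} (G : SimpleGraph (Fin n)) (m : ℝ) : Prop :=
  ∃ v : Fin n, v.val = 0 ∧ ∃ w : G.Walk v v, w.IsHamiltonianCycle ∧ (w.inversions : ℝ) ≤ m

/-! Non-existence is a first-moment bound. Inversion codes embed the permutations into products of
ranges, so the generating function of inversions is at most `(1 - x)⁻¹ ^ n`. At `x = M / (M + n)`
this gives at most `(e (1 + M / n)) ^ n` permutations with at most `M` inversions. Each gives a
Hamilton cycle present with probability `p ^ n`. As `n / M → 0`, the union bound decays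
exponentially once `p ≤ (1 - ε) n / (e M)`.

Existence restricts to a structured family of cycles. Cut the vertices into `{0}` and intervals of
length between `m` and `2m`, with `m` about `M / (2n)`, and use only permutations preserving every
interval. Inversions then occur only inside intervals, so there are at most `2mn ≤ M` of them. The
cycles of these permutations are spread: a set `S` of edges lies in at most a `(4e / m) ^ |S|`
fraction of them (`card_subset_cycleEdges_le`), since prescribing which vertex follows which removes
that many free choices from the factorials counting the permutations.

A spread family is covered by a random set of density about `q log n`, where `q = 4e / m`
(`card_mul_binomialSum_not_covered_le`). Edges are exposed in rounds, and after a round each cycle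
is replaced by a minimal fragment still to be found. Large fragments are rare because a fragment `T`
modulo `W` can be recovered from `W ∪ T` at the cost of choosing a subset of a single hyperedge.
About `log n` rounds of density `64 q` halve the fragment size down to some `L`, and a last round of
density `q R`, where `R` is the number of halving rounds, finishes. -/

/-! ### Expectations over binomial random subsets of a finite set. -/

section BinomialSum

variable {α : Type*} [DecidableEq α]

/-- The expectation of `f W` for a random subset `W` of `u` containing each element of `u`
independently with probability `p`. -/
noncomputable def binomialSum (u : Finset α) (p : ℝ) (f : Finset α → ℝ) : ℝ :=
  ∑ W ∈ u.powerset, p ^ W.card * (1 - p) ^ (u \ W).card * f W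

lemma binomialSum_insert {a : α} {u : Finset α} (ha : a ∉ u) (p : ℝ) (f : Finset α → ℝ) :
    binomialSum (insert a u) p f =
      (1 - p) * binomialSum u p f + p * binomialSum u p (fun W => f (insert a W)) := by
  unfold binomialSum
  rw [Finset.sum_powerset_insert ha, Finset.mul_sum, Finset.mul_sum]
  congr 1
  · refine Finset.sum_congr rfl fun W hW => ?_
    have haW : a ∉ W := fun h => ha (Finset.mem_powerset.1 hW h)
    rw [Finset.insert_sdiff_of_notMem _ haW, Finset.card_insert_of_notMem (by simp [ha])]
    ring
  · refine Finset.sum_congr rfl fun W hW => ?_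
    have haW : a ∉ W := fun h => ha (Finset.mem_powerset.1 hW h)
    have : insert a u \ insert a W = u \ W := by
      ext x; simp only [Finset.mem_sdiff, Finset.mem_insert]; grind
    rw [this, Finset.card_insert_of_notMem haW]
    ring

lemma binomialSum_add (u : Finset α) (p : ℝ) (f g : Finset α → ℝ) :
    binomialSum u p (fun W => f W + g W) = binomialSum u p f + binomialSum u p g := by
  simp [binomialSum, mul_add, Finset.sum_add_distrib]

lemma binomialSum_const_mul (u : Finset α) (p c : ℝ) (f : Finset α → ℝ) :
    binomialSum u p (fun W => c * f W) = c * binomialSum u p f := by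
  simp only [binomialSum, Finset.mul_sum]
  exact Finset.sum_congr rfl fun W _ => by ring

lemma binomialSum_const (u : Finset α) (p c : ℝ) : binomialSum u p (fun _ => c) = c := by
  induction u using Finset.induction_on with
  | empty => simp [binomialSum]
  | insert a u ha ih => rw [binomialSum_insert ha, ih]; ring

lemma binomialSum_mono {u : Finset α} {p : ℝ} (h0 : 0 ≤ p) (h1 : p ≤ 1) {f g : Finset α → ℝ}
    (h : ∀ W ⊆ u, f W ≤ g W) : binomialSum u p f ≤ binomialSum u p g := by
  refine Finset.sum_le_sum fun W hW => ?_
  have : 0 ≤ 1 - p := by linarith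
  exact mul_le_mul_of_nonneg_left (h W (Finset.mem_powerset.1 hW)) (by positivity)

/-- The union of independent binomial random sets is a binomial random set. -/
lemma binomialSum_union (u : Finset α) (p r : ℝ) (f : Finset α → ℝ) :
    binomialSum u p (fun W => binomialSum u r (fun Z => f (W ∪ Z))) =
      binomialSum u (1 - (1 - p) * (1 - r)) f := by
  induction u using Finset.induction_on generalizing f with
  | empty => simp [binomialSum]
  | insert a u ha ih =>
    simp only [binomialSum_insert ha, binomialSum_add, binomialSum_const_mul,
      Finset.insert_union, Finset.union_insert, Finset.insert_idem]
    rw [ih f, ih (fun W => f (insert a W))]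
    ring

/-- The expectation of a decreasing function decreases in the density of the random set. -/
lemma binomialSum_antitone {u : Finset α} {p p' : ℝ} (h0 : 0 ≤ p) (h : p ≤ p') (h1 : p' ≤ 1)
    {f : Finset α → ℝ} (hf : ∀ W Z, W ⊆ Z → f Z ≤ f W) :
    binomialSum u p' f ≤ binomialSum u p f := by
  rcases eq_or_lt_of_le (h.trans h1) with rfl | hp
  · rw [le_antisymm h1 h]
  have hp' : 0 < 1 - p := by linarith
  obtain ⟨r, hr0, hr1, rfl⟩ : ∃ r : ℝ, 0 ≤ r ∧ r ≤ 1 ∧ p' = 1 - (1 - p) * (1 - r) := by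
    refine ⟨(p' - p) / (1 - p), div_nonneg (by linarith) hp'.le, ?_, ?_⟩
    · rw [div_le_one hp']; linarith
    · field_simp; ring
  rw [← binomialSum_union]
  refine binomialSum_mono h0 (by linarith) fun W _ => ?_
  calc binomialSum u r (fun Z => f (W ∪ Z)) ≤ binomialSum u r (fun _ => f W) :=
        binomialSum_mono hr0 hr1 fun Z _ => hf _ _ Finset.subset_union_left
    _ = f W := binomialSum_const _ _ _

lemma binomialSum_superset {u S : Finset α} (hS : S ⊆ u) (p : ℝ) :
    binomialSum u p (fun W => if S ⊆ W then 1 else 0) = p ^ S.card := by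
  induction u using Finset.induction_on generalizing S with
  | empty => obtain rfl := Finset.subset_empty.1 hS; simp [binomialSum]
  | insert a u ha ih =>
    rw [binomialSum_insert ha]
    by_cases haS : a ∈ S
    · have h1 : binomialSum u p (fun W => if S ⊆ W then 1 else 0) = 0 := by
        refine Finset.sum_eq_zero fun W hW => ?_
        have h : ¬ S ⊆ W := fun h => ha (Finset.mem_powerset.1 hW (h haS))
        simp [h]
      have h2 : ∀ W : Finset α, S ⊆ insert a W ↔ S.erase a ⊆ W := fun W =>
        Finset.subset_insert_iff
      simp only [h1, h2]
      rw [ih (Finset.subset_insert_iff.1 hS), ← Finset.card_erase_add_one haS]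
      ring
    · have hSu : S ⊆ u := (Finset.subset_insert_iff_of_notMem haS).1 hS
      have h2 : ∀ W : Finset α, S ⊆ insert a W ↔ S ⊆ W := fun W =>
        Finset.subset_insert_iff_of_notMem haS
      simp only [h2, ih hSu]
      ring

end BinomialSum

/-! ### Minimal fragments and covering by spread hypergraphs. -/

section Spread

variable {α ι : Type*} [DecidableEq α]

/-- Every hyperedge has, modulo `W`, a minimal fragment. -/
lemma exists_minimal_fragment (G : Finset ι) (H : ι → Finset α) (W : Finset α) :
    ∃ T : ι → Finset α, ∀ i ∈ G, T i ⊆ H i ∧ Disjoint W (T i) ∧ (∃ j ∈ G, H j ⊆ W ∪ T i) ∧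
      ∀ j ∈ G, H j ⊆ W ∪ T i → T i ⊆ H j := by
  have key : ∀ i ∈ G, ∃ T : Finset α, T ⊆ H i ∧ Disjoint W T ∧ (∃ j ∈ G, H j ⊆ W ∪ T) ∧
      ∀ j ∈ G, H j ⊆ W ∪ T → T ⊆ H j := by
    intro i hi
    -- Minimality gives the crucial last property: any hyperedge inside `W ∪ T` has its part outside
    -- `W` contained in `T`, hence equal to `T`, so it contains `T`.
    obtain ⟨j, hj, hmin⟩ := Finset.exists_min_image (G.filter fun j => H j \ W ⊆ H i)
      (fun j => (H j \ W).card) ⟨i, by simp [hi]⟩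
    rw [Finset.mem_filter] at hj
    refine ⟨H j \ W, hj.2, Finset.disjoint_sdiff, ⟨j, hj.1, by simp⟩, fun k hk hkW => ?_⟩
    have hsub : H k \ W ⊆ H j \ W := by
      intro x hx
      have := hkW (Finset.mem_sdiff.1 hx).1
      simp only [Finset.mem_union, Finset.mem_sdiff] at this hx ⊢
      tauto
    have := Finset.eq_of_subset_of_card_le hsub
      (hmin k (Finset.mem_filter.2 ⟨hk, hsub.trans hj.2⟩))
    rw [← this]
    exact Finset.sdiff_subset
  choose! T hT using key
  exact ⟨T, hT⟩

/-- A `q`-spread hypergraph has few large fragments modulo a binomial random set. -/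
lemma binomialSum_card_large_fragments_le {u : Finset α} {G : Finset ι} {H : ι → Finset α}
    {a q N B : ℝ} {ℓ k : ℕ} (ha0 : 0 < a) (ha1 : a ≤ 1) (hq : 0 ≤ q) (hN : 0 ≤ N) (hB : 0 ≤ B)
    (hu : ∀ i ∈ G, H i ⊆ u) (hℓ : ∀ i ∈ G, (H i).card ≤ ℓ)
    (hspread : ∀ S : Finset α, ((G.filter fun i => S ⊆ H i).card : ℝ) ≤ N * q ^ S.card)
    (hsum : ∀ S : Finset α, S.card ≤ ℓ →
      ∑ T ∈ S.powerset with k < T.card, (q / a) ^ T.card ≤ B)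
    (T : Finset α → ι → Finset α)
    (hT : ∀ W, ∀ i ∈ G, T W i ⊆ H i ∧ Disjoint W (T W i) ∧ (∃ j ∈ G, H j ⊆ W ∪ T W i) ∧
      ∀ j ∈ G, H j ⊆ W ∪ T W i → T W i ⊆ H j) :
    binomialSum u a (fun W => ((G.filter fun i => k < (T W i).card).card : ℝ)) ≤ N * B := by
  classical
  rcases G.eq_empty_or_nonempty with rfl | ⟨i₀, -⟩
  · simpa [binomialSum] using mul_nonneg hN hB
  have ha1' : 0 ≤ 1 - a := by linarith
  set wt : Finset α → ℝ := fun W => a ^ W.card * (1 - a) ^ (u \ W).card with hwt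
  have hwt0 : ∀ W, 0 ≤ wt W := fun W => by positivity
  set U : Finset α → Finset (Finset α) := fun W =>
    (G.image (T W)).filter fun S => k < S.card with hU
  -- Hyperedges sharing a fragment `S` all contain `S`, so spreadness bounds their number; only
  -- distinct fragments remain to be counted.
  have h1 : ∀ W, ((G.filter fun i => k < (T W i).card).card : ℝ) ≤
      N * ∑ S ∈ U W, q ^ S.card := by
    intro W
    have hsub : (G.filter fun i => k < (T W i).card) ⊆
        (U W).biUnion fun S => G.filter fun i => S ⊆ H i := by
      intro i hi
      rw [Finset.mem_filter] at hi
      refine Finset.mem_biUnion.2 ⟨T W i, ?_, ?_⟩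
      · exact Finset.mem_filter.2 ⟨Finset.mem_image_of_mem _ hi.1, hi.2⟩
      · exact Finset.mem_filter.2 ⟨hi.1, (hT W i hi.1).1⟩
    calc ((G.filter fun i => k < (T W i).card).card : ℝ)
        ≤ ((∑ S ∈ U W, (G.filter fun i => S ⊆ H i).card : ℕ) : ℝ) := by
          exact_mod_cast (Finset.card_le_card hsub).trans Finset.card_biUnion_le
      _ ≤ ∑ S ∈ U W, N * q ^ S.card := by
          push_cast
          exact Finset.sum_le_sum fun S _ => hspread S
      _ = _ := by rw [Finset.mul_sum]
  -- every set containing a hyperedge contains a chosen one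
  have hch : ∃ g : Finset α → ι, ∀ Z, (∃ j ∈ G, H j ⊆ Z) → g Z ∈ G ∧ H (g Z) ⊆ Z := by
    have : ∀ Z : Finset α, ∃ i : ι, (∃ j ∈ G, H j ⊆ Z) → i ∈ G ∧ H i ⊆ Z := by
      intro Z
      by_cases h : ∃ j ∈ G, H j ⊆ Z
      · obtain ⟨j, hj⟩ := h
        exact ⟨j, fun _ => hj⟩
      · exact ⟨i₀, fun h' => absurd h' h⟩
    choose g hg using this
    exact ⟨g, hg⟩
  obtain ⟨g, hg⟩ := hch
  -- The hyperedge `H (g Z)` depends on `Z` alone, yet contains every fragment `S` with `Z = W ∪ S`.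
  -- So, given `Z`, the candidates for `S` are subsets of one set of size at most `ℓ`.
  set V : Finset α → Finset (Finset α) := fun Z =>
    (if g Z ∈ G then (H (g Z)).powerset else ∅).filter fun S => k < S.card with hV
  have h2 : ∑ W ∈ u.powerset, ∑ S ∈ U W, wt W * q ^ S.card ≤
      ∑ Z ∈ u.powerset, ∑ S ∈ V Z, wt Z * (q / a) ^ S.card := by
    rw [Finset.sum_sigma', Finset.sum_sigma']
    -- `W` is recovered as `(W ∪ S) \ S` by disjointness. Passing from `W` to `W ∪ S` multiplies the
    -- weight by `(a / (1 - a)) ^ |S|` when `a < 1`; in all cases `wt W ≤ wt (W ∪ S) / a ^ |S|`,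
    -- which turns `q` into `q / a`.
    set φ : (Σ _ : Finset α, Finset α) → (Σ _ : Finset α, Finset α) :=
      fun x => ⟨x.1 ∪ x.2, x.2⟩ with hφ
    have hmem : ∀ x ∈ u.powerset.sigma U, x.1 ⊆ u ∧ x.2 ⊆ u ∧ Disjoint x.1 x.2 ∧
        φ x ∈ u.powerset.sigma V := by
      rintro ⟨W, S⟩ hx
      simp only [Finset.mem_sigma, Finset.mem_powerset, hU, Finset.mem_filter,
        Finset.mem_image] at hx
      obtain ⟨hW, ⟨i, hi, rfl⟩, hk⟩ := hx
      obtain ⟨t1, t2, t3, t4⟩ := hT W i hi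
      have hTu := t1.trans (hu i hi)
      refine ⟨hW, hTu, t2, ?_⟩
      obtain ⟨g1, g2⟩ := hg _ t3
      simp only [hφ, Finset.mem_sigma, Finset.mem_powerset, hV, Finset.mem_filter, if_pos g1]
      exact ⟨Finset.union_subset hW hTu, t4 _ g1 g2, hk⟩
    have hinj : Set.InjOn φ (u.powerset.sigma U : Finset _) := by
      rintro ⟨W, S⟩ hx ⟨W', S'⟩ hy h
      have d1 := (hmem _ hx).2.2.1
      have d2 := (hmem _ hy).2.2.1
      simp only [hφ, Sigma.mk.injEq, heq_eq_eq] at h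
      obtain ⟨h, rfl⟩ := h
      simp only [Sigma.mk.injEq, heq_eq_eq, and_true]
      dsimp only at d1 d2
      rw [← Finset.union_sdiff_cancel_right d1, h, Finset.union_sdiff_cancel_right d2]
    calc ∑ x ∈ u.powerset.sigma U, wt x.1 * q ^ x.2.card
        ≤ ∑ x ∈ u.powerset.sigma U, wt (φ x).1 * (q / a) ^ (φ x).2.card := by
          refine Finset.sum_le_sum fun x hx => ?_
          obtain ⟨m1, m2, m3, -⟩ := hmem x hx
          have c1 : (x.1 ∪ x.2).card = x.1.card + x.2.card := Finset.card_union_of_disjoint m3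
          have c2 : (u \ x.1).card = (u \ (x.1 ∪ x.2)).card + x.2.card := by
            have := Finset.card_sdiff_add_card_eq_card m1
            have := Finset.card_sdiff_add_card_eq_card (Finset.union_subset m1 m2)
            omega
          simp only [hφ, hwt, c1, c2, div_pow, pow_add]
          have : a ^ x.1.card * a ^ x.2.card * (1 - a) ^ (u \ (x.1 ∪ x.2)).card *
              (q ^ x.2.card / a ^ x.2.card) =
              a ^ x.1.card * (1 - a) ^ (u \ (x.1 ∪ x.2)).card * q ^ x.2.card := by
            field_simp
          rw [this]
          refine mul_le_mul_of_nonneg_right ?_ (by positivity)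
          refine mul_le_mul_of_nonneg_left ?_ (by positivity)
          exact mul_le_of_le_one_right (by positivity) (pow_le_one₀ ha1' (by linarith))
      _ = ∑ x ∈ (u.powerset.sigma U).image φ, wt x.1 * (q / a) ^ x.2.card := by
          rw [Finset.sum_image hinj]
      _ ≤ _ := by
          refine Finset.sum_le_sum_of_subset_of_nonneg ?_ fun x _ _ =>
            mul_nonneg (hwt0 _) (by positivity)
          intro y hy
          obtain ⟨x, hx, rfl⟩ := Finset.mem_image.1 hy
          exact (hmem x hx).2.2.2
  calc binomialSum u a (fun W => ((G.filter fun i => k < (T W i).card).card : ℝ))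
      ≤ binomialSum u a (fun W => N * ∑ S ∈ U W, q ^ S.card) :=
        binomialSum_mono ha0.le ha1 fun W _ => h1 W
    _ = N * ∑ W ∈ u.powerset, ∑ S ∈ U W, wt W * q ^ S.card := by
        rw [binomialSum_const_mul]
        simp only [binomialSum, Finset.mul_sum, hwt]
    _ ≤ N * ∑ Z ∈ u.powerset, ∑ S ∈ V Z, wt Z * (q / a) ^ S.card :=
        mul_le_mul_of_nonneg_left h2 hN
    _ ≤ N * ∑ Z ∈ u.powerset, wt Z * B := by
        refine mul_le_mul_of_nonneg_left (Finset.sum_le_sum fun Z _ => ?_) hN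
        rw [← Finset.mul_sum]
        refine mul_le_mul_of_nonneg_left ?_ (hwt0 Z)
        by_cases h : g Z ∈ G
        · simp only [hV, if_pos h]
          exact hsum _ (hℓ _ h)
        · simpa [hV, if_neg h] using hB
    _ = N * B := by
        congr 1
        exact binomialSum_const u a B

open Classical in
/-- A random set contains a member of a spread hypergraph with high probability. -/
theorem card_mul_binomialSum_not_covered_le {u : Finset α} {a b q N : ℝ} {L : ℕ}
    (ha0 : 0 < a) (ha1 : a ≤ 1) (hb0 : 0 < b) (hb1 : b ≤ 1) (hq : 0 ≤ q) (hqa : 64 * q ≤ a)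
    (hN : 0 ≤ N) (r : ℕ) (G : Finset ι) (H : ι → Finset α)
    (hu : ∀ i ∈ G, H i ⊆ u) (hℓ : ∀ i ∈ G, (H i).card ≤ L * 2 ^ r)
    (hspread : ∀ S : Finset α, ((G.filter fun i => S ⊆ H i).card : ℝ) ≤ N * q ^ S.card) :
    (G.card : ℝ) * binomialSum u (1 - (1 - b) * (1 - a) ^ r)
      (fun W => if ∃ i ∈ G, H i ⊆ W then 0 else 1) ≤
      N * (r * (1 / 16) ^ L + ((1 + q / b) ^ L - 1)) := by
  -- one round of exposure
  have round : ∀ {c p' B β : ℝ} {ℓ k : ℕ} (G : Finset ι) (H : ι → Finset α),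
      0 < c → c ≤ 1 → 0 ≤ p' → p' ≤ 1 → 0 ≤ B →
      (∀ i ∈ G, H i ⊆ u) → (∀ i ∈ G, (H i).card ≤ ℓ) →
      (∀ S : Finset α, ((G.filter fun i => S ⊆ H i).card : ℝ) ≤ N * q ^ S.card) →
      (∀ S : Finset α, S.card ≤ ℓ → ∑ T ∈ S.powerset with k < T.card, (q / c) ^ T.card ≤ B) →
      (∀ (G' : Finset ι) (H' : ι → Finset α), (∀ i ∈ G', H' i ⊆ u) →
        (∀ i ∈ G', (H' i).card ≤ k) →
        (∀ S : Finset α, ((G'.filter fun i => S ⊆ H' i).card : ℝ) ≤ N * q ^ S.card) →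
        (G'.card : ℝ) * binomialSum u p' (fun W => if ∃ i ∈ G', H' i ⊆ W then 0 else 1) ≤ β) →
      (G.card : ℝ) * binomialSum u (1 - (1 - c) * (1 - p'))
        (fun W => if ∃ i ∈ G, H i ⊆ W then 0 else 1) ≤ N * B + β := by
    intro c p' B β ℓ k G H hc0 hc1 hp0 hp1 hB hu hℓ hspread hsum hrec
    choose T hT using exists_minimal_fragment G H
    have hfrag := binomialSum_card_large_fragments_le hc0 hc1 hq hN hB hu hℓ hspread hsum T hT
    rw [← binomialSum_union, ← binomialSum_const_mul]
    calc _ ≤ binomialSum u c (fun W => ((G.filter fun i => k < (T W i).card).card : ℝ) + β) := by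
          refine binomialSum_mono hc0.le hc1 fun W _ => ?_
          -- Hyperedges with large fragments are charged failure probability at most 1. The small
          -- fragments form the hypergraph of the next round.
          set G' := G.filter fun i => ¬ k < (T W i).card with hG'
          have hcard : (G.card : ℝ) = (G.filter fun i => k < (T W i).card).card + G'.card := by
            exact_mod_cast (Finset.card_filter_add_card_filter_not _).symm
          set e := binomialSum u p' (fun Z => if ∃ i ∈ G, H i ⊆ W ∪ Z then (0 : ℝ) else 1)
          have he1 : e ≤ 1 := by
            rw [← binomialSum_const u p' 1]
            refine binomialSum_mono hp0 hp1 fun Z _ => ?_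
            split_ifs <;> norm_num
          have he2 : e ≤ binomialSum u p' (fun Z => if ∃ i ∈ G', T W i ⊆ Z then 0 else 1) := by
            refine binomialSum_mono hp0 hp1 fun Z _ => ?_
            by_cases h : ∃ i ∈ G', T W i ⊆ Z
            · obtain ⟨i, hi, hiZ⟩ := h
              obtain ⟨j, hj, hjW⟩ := (hT W i (Finset.mem_filter.1 hi).1).2.2.1
              rw [if_pos ⟨j, hj, hjW.trans (Finset.union_subset_union_right hiZ)⟩]
              split_ifs <;> norm_num
            · rw [if_neg h]
              split_ifs <;> norm_num
          -- Fragments inherit the spread bound with the same `N`, although `G'` may be smaller than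
          -- `G`. Bounding `|G|` times the failure probability by a multiple of `N` avoids any
          -- renormalisation.
          have hr := hrec G' (T W)
            (fun i hi => ((hT W i (Finset.mem_filter.1 hi).1).1).trans
              (hu i (Finset.mem_filter.1 hi).1))
            (fun i hi => not_lt.1 (Finset.mem_filter.1 hi).2)
            (fun S => by
              refine le_trans ?_ (hspread S)
              norm_cast
              refine Finset.card_le_card fun i hi => ?_
              simp only [hG', Finset.mem_filter] at hi ⊢
              exact ⟨hi.1.1, hi.2.trans (hT W i hi.1.1).1⟩)
          rw [hcard, add_mul]
          refine add_le_add (mul_le_of_le_one_right (by positivity) he1) (le_trans ?_ hr)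
          exact mul_le_mul_of_nonneg_left he2 (by positivity)
      _ ≤ N * B + β := by
          rw [binomialSum_add, binomialSum_const]
          linarith
  have pow_sum : ∀ (S : Finset α) (x : ℝ), ∑ T ∈ S.powerset, x ^ T.card = (1 + x) ^ S.card := by
    intro S x
    rw [add_comm, ← Finset.sum_pow_mul_eq_add_pow]
    simp
  induction r generalizing G H with
  | zero =>
    have hqb : 0 ≤ q / b := by positivity
    have hB : 0 ≤ (1 + q / b) ^ L - 1 := by
      have := one_le_pow₀ (n := L) (by linarith : 1 ≤ 1 + q / b)
      linarith
    -- With threshold `k = 0` every nonempty fragment counts as large. A surviving fragment is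
    -- empty, so nothing further needs to be exposed.
    have := round (p' := 0) (B := (1 + q / b) ^ L - 1) (β := 0) (ℓ := L) (k := 0) G H hb0 hb1
      le_rfl zero_le_one hB hu (by simpa using hℓ) hspread ?_ ?_
    · simpa using this
    · intro S hS
      have h0 : ∑ T ∈ S.powerset with 0 < T.card, (q / b) ^ T.card = (1 + q / b) ^ S.card - 1 := by
        rw [← pow_sum, Finset.sum_filter, eq_sub_iff_add_eq]
        have : ∀ T ∈ S.powerset, (q / b) ^ T.card =
            (if 0 < T.card then (q / b) ^ T.card else 0) + if T = ∅ then 1 else 0 := by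
          intro T _
          rcases T.eq_empty_or_nonempty with rfl | hT
          · simp
          · simp [hT.ne_empty, hT]
        rw [Finset.sum_congr rfl this, Finset.sum_add_distrib]
        simp
      rw [h0]
      have := pow_le_pow_right₀ (by linarith : 1 ≤ 1 + q / b) hS
      linarith
    · intro G' H' _ hk _
      rcases G'.eq_empty_or_nonempty with rfl | ⟨i, hi⟩
      · simp
      · have : ∀ W, ∃ i ∈ G', H' i ⊆ W := fun W =>
          ⟨i, hi, by rw [Finset.card_eq_zero.1 (Nat.le_zero.1 (hk i hi))]; simp⟩
        simp [this, binomialSum]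
  | succ r ih =>
    have hp0 : 0 ≤ (1 - b) * (1 - a) ^ r :=
      mul_nonneg (by linarith) (pow_nonneg (by linarith) _)
    have hp1 : (1 - b) * (1 - a) ^ r ≤ 1 :=
      mul_le_one₀ (by linarith) (pow_nonneg (by linarith) _)
        (pow_le_one₀ (by linarith) (by linarith))
    have := round (p' := 1 - (1 - b) * (1 - a) ^ r) (B := (1 / 16) ^ L)
      (β := N * (r * (1 / 16) ^ L + ((1 + q / b) ^ L - 1))) (ℓ := L * 2 ^ (r + 1))
      (k := L * 2 ^ r) G H ha0 ha1 (by linarith) (by linarith) (by positivity) hu hℓ hspread ?_ ?_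
    · have e : 1 - (1 - a) * (1 - (1 - (1 - b) * (1 - a) ^ r)) =
          1 - (1 - b) * (1 - a) ^ (r + 1) := by ring
      rw [e] at this
      refine this.trans (le_of_eq ?_)
      push_cast
      ring
    · intro S hS
      have hx0 : 0 ≤ q / a := by positivity
      have hx : q / a ≤ 1 / 64 := by
        rw [div_le_div_iff₀ ha0 (by norm_num)]; linarith
      set k := L * 2 ^ r with hk
      have hLk : L ≤ k := Nat.le_mul_of_pos_right _ (by positivity)
      -- A set of size at most `2k` has at most `4 ^ k` subsets, and each large one weighs at most
      -- `64⁻ᵏ`; this is where the factor 64 in `a` is used.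
      calc ∑ T ∈ S.powerset with k < T.card, (q / a) ^ T.card
          ≤ ∑ T ∈ S.powerset with k < T.card, (1 / 64 : ℝ) ^ k := by
            refine Finset.sum_le_sum fun T hT => ?_
            calc (q / a) ^ T.card ≤ (1 / 64 : ℝ) ^ T.card := pow_le_pow_left₀ hx0 hx _
              _ ≤ _ := pow_le_pow_of_le_one (by norm_num) (by norm_num)
                (Finset.mem_filter.1 hT).2.le
        _ ≤ ∑ T ∈ S.powerset, (1 / 64 : ℝ) ^ k :=
            Finset.sum_le_sum_of_subset_of_nonneg (Finset.filter_subset _ _)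
              fun _ _ _ => by positivity
        _ = 2 ^ S.card * (1 / 64 : ℝ) ^ k := by simp
        _ ≤ 2 ^ (2 * k) * (1 / 64 : ℝ) ^ k := by
            refine mul_le_mul_of_nonneg_right ?_ (by positivity)
            refine pow_le_pow_right₀ (by norm_num) (hS.trans (le_of_eq ?_))
            rw [hk]; ring
        _ = (1 / 16 : ℝ) ^ k := by rw [pow_mul, ← mul_pow]; norm_num
        _ ≤ (1 / 16 : ℝ) ^ L := pow_le_pow_of_le_one (by norm_num) (by norm_num) hLk
    · intro G' H' hu' hk' hs'
      exact ih G' H' hu' hk' hs'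

end Spread

/-! ### Hamilton cycles as permutations fixing 0. -/

section HamiltonCycles

/-- The edges of the closed walk visiting `σ 0, σ 1, …` and returning to `σ 0`. -/
def cycleEdges {n : ℕ} [NeZero n] (σ : Equiv.Perm (Fin n)) : Finset (Sym2 (Fin n)) :=
  Finset.univ.image fun i => s(σ i, σ (i + 1))

/-- The number of inversions of a permutation of `Fin n`. -/
def permInversions {n : ℕ} (σ : Equiv.Perm (Fin n)) : ℕ :=
  (Finset.univ.filter fun q : Fin n × Fin n => q.1 < q.2 ∧ σ q.2 < σ q.1).card

lemma Fin.add_two_ne_self {k : ℕ} (i : Fin (k + 3)) : i + 1 + 1 ≠ i := by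
  intro h
  have h2 : (1 + 1 : Fin (k + 3)) = 0 := by
    rw [add_assoc] at h
    exact left_eq_add.1 h.symm
  have := congrArg Fin.val h2
  rw [Fin.val_add] at this
  simp at this
  rw [Nat.mod_eq_of_lt (by omega)] at this
  omega

/-- Two positions could share an edge only by traversing it in opposite directions, which would
force `2 = 0` in `Fin (k + 3)`; hence the requirement of at least three vertices. -/
lemma cycleEdge_injective {k : ℕ} (σ : Equiv.Perm (Fin (k + 3))) :
    Function.Injective fun i => s(σ i, σ (i + 1)) := by
  intro i j h
  simp only [Sym2.eq_iff, EmbeddingLike.apply_eq_iff_eq] at h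
  rcases h with h | ⟨h1, h2⟩
  · exact h.1
  · exact absurd (h1 ▸ h2) (Fin.add_two_ne_self j)

lemma card_cycleEdges {k : ℕ} (σ : Equiv.Perm (Fin (k + 3))) :
    (cycleEdges σ).card = k + 3 := by
  rw [cycleEdges, Finset.card_image_of_injective _ (cycleEdge_injective σ), Finset.card_univ,
    Fintype.card_fin]

lemma cycleEdges_subset {k : ℕ} (σ : Equiv.Perm (Fin (k + 3))) :
    cycleEdges σ ⊆ Finset.univ.filter fun e => ¬ e.IsDiag := by
  intro e he
  obtain ⟨i, -, rfl⟩ := Finset.mem_image.1 he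
  simp

open Classical in
lemma hasHamiltonCycleWithInversionsLE_iff {k : ℕ} (G : SimpleGraph (Fin (k + 3))) (m : ℝ) :
    HasHamiltonCycleWithInversionsLE G m ↔ ∃ σ : Equiv.Perm (Fin (k + 3)), σ 0 = 0 ∧
      (permInversions σ : ℝ) ≤ m ∧ cycleEdges σ ⊆ G.edgeFinset := by
  constructor
  · rintro ⟨v, hv, w, hw, hm⟩
    obtain rfl : v = 0 := Fin.ext hv
    have hlen : w.length = k + 3 := by simpa using hw.length_eq
    have hinj : Function.Injective fun i : Fin (k + 3) => w.getVert i := by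
      intro i j h
      refine Fin.ext (hw.isCycle.getVert_injOn' ?_ ?_ h)
      · simp only [Set.mem_ofPred_eq, hlen]; omega
      · simp only [Set.mem_ofPred_eq, hlen]; omega
    set σ := Equiv.ofBijective _ (Finite.injective_iff_bijective.1 hinj) with hσ
    have hσa : ∀ i, σ i = w.getVert i := fun i => rfl
    refine ⟨σ, by simp [hσa], hm, ?_⟩
    intro e he
    obtain ⟨i, -, rfl⟩ := Finset.mem_image.1 he
    rw [SimpleGraph.mem_edgeFinset, SimpleGraph.mem_edgeSet, hσa, hσa]
    have hadj := w.adj_getVert_succ (i := i) (by omega)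
    rcases eq_or_ne i (Fin.last _) with rfl | hi
    · have h1 : w.getVert ((Fin.last (k + 2) : Fin _) + 1 : ℕ) = w.getVert 0 := by
        have : ((Fin.last (k + 2) : Fin _) + 1 : ℕ) = w.length := by simp [hlen]
        rw [this, w.getVert_length, w.getVert_zero]
      rw [h1] at hadj
      simpa using hadj
    · rwa [Fin.val_add_one_of_lt (Fin.lt_last_iff_ne_last.2 hi)]
  · rintro ⟨σ, hσ, hm, hE⟩
    have hadj : ∀ i, G.Adj (σ i) (σ (i + 1)) := by
      intro i
      have := hE (Finset.mem_image_of_mem _ (Finset.mem_univ i))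
      rwa [SimpleGraph.mem_edgeFinset, SimpleGraph.mem_edgeSet] at this
    let f : SimpleGraph.cycleGraph (k + 3) →g G :=
      { toFun := σ
        map_rel' := by
          intro a b hab
          have : a - b = 1 ∨ b - a = 1 := SimpleGraph.cycleGraph_adj.1 hab
          rcases this with h | h
          · rw [sub_eq_iff_eq_add'] at h
            rw [h]; exact (hadj b).symm
          · rw [sub_eq_iff_eq_add'] at h
            rw [h]; exact hadj a }
    -- The standard cycle runs through decreasing indices; reversing it makes the `i`-th vertex of
    -- the walk equal to `σ i`.
    refine ⟨f 0, by simp [f, hσ], (SimpleGraph.cycleGraph.cycle k).reverse.map f, ?_, ?_⟩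
    · have hc : ((SimpleGraph.cycleGraph.cycle k).reverse.map f).IsCycle :=
        SimpleGraph.cycleGraph.isCycle_cycle.reverse.map σ.injective
      rw [SimpleGraph.Walk.isHamiltonianCycle_iff_isCycle_and_length_eq]
      refine ⟨hc, ?_⟩
      simp [SimpleGraph.cycleGraph.length_cycle]
    · convert hm using 2
      unfold SimpleGraph.Walk.inversions permInversions
      congr 1
      refine Finset.filter_congr fun q _ => ?_
      have hg : ∀ i : Fin (k + 3), ((SimpleGraph.cycleGraph.cycle k).reverse.map f).getVert i = σ i := by
        intro i
        rw [SimpleGraph.Walk.getVert_map, SimpleGraph.Walk.getVert_reverse,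
          SimpleGraph.cycleGraph.length_cycle, SimpleGraph.cycleGraph.getVert_cycle (by omega)]
        change σ _ = σ i
        congr 1
        apply Fin.ext
        change (k + 3 - (k + 3 - (i : ℕ))) % (k + 3) = i
        rw [Nat.sub_sub_self i.2.le, Nat.mod_eq_of_lt i.2]
      rw [hg, hg]

end HamiltonCycles

/-! ### The random graph as a binomial random edge set. -/

section RandomGraph

open Classical MeasureTheory in
lemma binomialRandom_real_eq_binomialSum {V : Type*} [Fintype V] [DecidableEq V] (p : unitInterval)
    (P : Finset (Sym2 V) → Prop) :
    (SimpleGraph.binomialRandom V p).real {G | P G.edgeFinset} =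
      binomialSum (Finset.univ.filter fun e : Sym2 V => ¬ e.IsDiag) p
        (fun W => if P W then 1 else 0) := by
  have : MeasurableSingletonClass (SimpleGraph V) := ⟨fun G => by
    rw [← SimpleGraph.measurableEmbedding_edgeSet.measurableSet_image, Set.image_singleton]
    exact MeasurableSet.singleton _⟩
  have hfin : ({G : SimpleGraph V | P G.edgeFinset}) =
      ↑(Finset.univ.filter fun G : SimpleGraph V => P G.edgeFinset) := by ext; simp
  have hd : (Sym2.diagSetᶜ : Set (Sym2 V)) =
      ↑(Finset.univ.filter fun e : Sym2 V => ¬ e.IsDiag) := by ext; simp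
  rw [hfin, ← sum_measureReal_singleton, Finset.sum_filter, binomialSum]
  refine Finset.sum_bij (fun G _ => G.edgeFinset) ?_ ?_ ?_ ?_
  · intro G _
    rw [Finset.mem_powerset]
    intro e he
    simp only [Finset.mem_filter, Finset.mem_univ, true_and]
    exact G.not_isDiag_of_mem_edgeFinset he
  · intro G _ G' _ h
    exact SimpleGraph.edgeFinset_inj.1 h
  · intro W hW
    refine ⟨SimpleGraph.fromEdgeSet (W : Set (Sym2 V)), Finset.mem_univ _, ?_⟩
    ext e
    simp only [SimpleGraph.mem_edgeFinset, SimpleGraph.edgeSet_fromEdgeSet]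
    have := Finset.mem_powerset.1 hW
    constructor
    · intro h; simpa using h.1
    · intro h; refine ⟨by simpa using h, ?_⟩
      simpa using this h
  · intro G _
    rw [mul_ite, mul_one, mul_zero]
    congr 1
    rw [measureReal_def, SimpleGraph.binomialRandom_apply', Set.image_singleton, ← measureReal_def,
      hd, ProbabilityTheory.setBernoulli_real_singleton]
    · rw [← SimpleGraph.coe_edgeFinset, ← Finset.coe_sdiff, Set.ncard_coe_finset,
        Set.ncard_coe_finset]
    · rw [← hd]; simp
    · exact Finset.finite_toSet _

end RandomGraph

/-! ### Counting permutations with few inversions. -/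

section Inversions

/-- The number of entries of `σ` that precede position `l` and exceed `σ l`. -/
def inversionCode {n : ℕ} (σ : Equiv.Perm (Fin n)) (l : Fin n) : ℕ :=
  (Finset.univ.filter fun k : Fin n => k < l ∧ σ l < σ k).card

lemma sum_inversionCode {n : ℕ} (σ : Equiv.Perm (Fin n)) :
    ∑ l, inversionCode σ l = permInversions σ := by
  simp only [inversionCode, permInversions, Finset.card_filter]
  rw [Fintype.sum_prod_type_right]

lemma inversionCode_lt {n : ℕ} (σ : Equiv.Perm (Fin n)) (l : Fin n) : inversionCode σ l < n := by
  calc inversionCode σ l < (Finset.univ : Finset (Fin n)).card := by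
        refine Finset.card_lt_card ⟨Finset.subset_univ _, fun h => ?_⟩
        simpa using h (Finset.mem_univ l)
    _ = n := by simp

/-- Consider the last position `l` where two permutations differ. Both use the same set of values at
positions up to `l`, and the code at `l` counts the members of this set exceeding the value at `l`,
so it determines that value. -/
lemma inversionCode_injective {n : ℕ} :
    Function.Injective (inversionCode : Equiv.Perm (Fin n) → Fin n → ℕ) := by
  have hcode : ∀ (σ : Equiv.Perm (Fin n)) (l : Fin n), inversionCode σ l =
      (Finset.univ.filter fun a : Fin n => σ.symm a ≤ l ∧ σ l < a).card := by
    intro σ l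
    refine Finset.card_bij (fun k _ => σ k) ?_ (fun a _ b _ h => σ.injective h) ?_
    · intro k hk
      simp only [Finset.mem_filter, Finset.mem_univ, true_and, Equiv.symm_apply_apply] at hk ⊢
      exact ⟨hk.1.le, hk.2⟩
    · intro a ha
      simp only [Finset.mem_filter, Finset.mem_univ, true_and] at ha
      refine ⟨σ.symm a, ?_, by simp⟩
      simp only [Finset.mem_filter, Finset.mem_univ, true_and, Equiv.apply_symm_apply]
      refine ⟨lt_of_le_of_ne ha.1 fun h => ?_, ha.2⟩
      rw [← h] at ha
      simp at ha
  have key : ∀ (σ τ : Equiv.Perm (Fin n)) (l : Fin n), (∀ k, l < k → σ k = τ k) →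
      inversionCode σ l = inversionCode τ l → ¬ σ l < τ l := by
    intro σ τ l hl hc hlt
    rw [hcode, hcode] at hc
    have hsymm : ∀ (σ τ : Equiv.Perm (Fin n)), (∀ k, l < k → σ k = τ k) →
        ∀ a, τ.symm a ≤ l → σ.symm a ≤ l := by
      intro σ τ hl a ha
      by_contra h
      have h1 := hl _ (not_le.1 h)
      rw [Equiv.apply_symm_apply] at h1
      exact h (by rw [h1, Equiv.symm_apply_apply] at ha; exact ha)
    refine absurd hc (ne_of_gt (Finset.card_lt_card ⟨?_, fun h => ?_⟩))
    · intro a ha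
      simp only [Finset.mem_filter, Finset.mem_univ, true_and] at ha ⊢
      exact ⟨hsymm σ τ hl a ha.1, hlt.trans ha.2⟩
    · have := @h (τ l) (by
        simp only [Finset.mem_filter, Finset.mem_univ, true_and]
        exact ⟨hsymm σ τ hl _ (by simp), hlt⟩)
      simp at this
  intro σ τ h
  by_contra hne
  have hex : (Finset.univ.filter fun l => σ l ≠ τ l).Nonempty := by
    by_contra h'
    rw [Finset.not_nonempty_iff_eq_empty, Finset.filter_eq_empty_iff] at h'
    exact hne (Equiv.ext fun l => not_not.1 (h' (Finset.mem_univ l)))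
  obtain ⟨l, hl, hmax⟩ := Finset.exists_max_image _ id hex
  have hagree : ∀ k, l < k → σ k = τ k := by
    intro k hk
    by_contra hk'
    exact absurd (hmax k (by simp [hk'])) (not_le.2 hk)
  rcases lt_or_gt_of_ne (Finset.mem_filter.1 hl).2 with h' | h'
  · exact key σ τ l hagree (congrFun h l) h'
  · exact key τ σ l (fun k hk => (hagree k hk).symm) (congrFun h l).symm h'

/-- The inversion number is the sum of the code entries and the code is injective. Enlarging the sum
to all functions makes it a product of truncated geometric series. -/
lemma sum_pow_permInversions_le (n : ℕ) {x : ℝ} (hx0 : 0 ≤ x) (hx1 : x < 1) :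
    ∑ σ : Equiv.Perm (Fin n), x ^ permInversions σ ≤ ((1 - x)⁻¹) ^ n := by
  have hgeom : ∑ j : Fin n, x ^ (j : ℕ) ≤ (1 - x)⁻¹ := by
    rw [Fin.sum_univ_eq_sum_range (fun j => x ^ j), ← tsum_geometric_of_lt_one hx0 hx1]
    exact (summable_geometric_of_lt_one hx0 hx1).sum_le_tsum _ fun _ _ => by positivity
  set φ : Equiv.Perm (Fin n) → Fin n → Fin n := fun σ l => ⟨_, inversionCode_lt σ l⟩ with hφ
  have hφi : Function.Injective φ := by
    intro σ τ h
    refine inversionCode_injective (funext fun l => ?_)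
    exact congrArg Fin.val (congrFun h l)
  calc ∑ σ : Equiv.Perm (Fin n), x ^ permInversions σ
      = ∑ σ : Equiv.Perm (Fin n), ∏ l, x ^ (φ σ l : ℕ) := by
        refine Finset.sum_congr rfl fun σ _ => ?_
        rw [← sum_inversionCode, Finset.prod_pow_eq_pow_sum]
    _ = ∑ c ∈ Finset.univ.image φ, ∏ l, x ^ (c l : ℕ) := by
        rw [Finset.sum_image fun a _ b _ h => hφi h]
    _ ≤ ∑ c : Fin n → Fin n, ∏ l, x ^ (c l : ℕ) :=
        Finset.sum_le_sum_of_subset_of_nonneg (Finset.subset_univ _) fun _ _ _ => by positivity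
    _ = ∏ _l : Fin n, ∑ j : Fin n, x ^ (j : ℕ) := by
        rw [Finset.prod_univ_sum]; simp
    _ ≤ ∏ _l : Fin n, (1 - x)⁻¹ :=
        Finset.prod_le_prod (fun _ _ => Finset.sum_nonneg fun _ _ => by positivity)
          fun _ _ => hgeom
    _ = _ := by simp

/-- There are at most `(e (1 + m / n)) ^ n` permutations with at most `m` inversions. -/
lemma card_permInversions_le {n : ℕ} (hn : 0 < n) {m : ℝ} (hm : 0 < m) :
    ((Finset.univ.filter fun σ : Equiv.Perm (Fin n) => (permInversions σ : ℝ) ≤ m).card : ℝ) ≤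
      (Real.exp 1 * ((m + n) / n)) ^ n := by
  have hn' : (0 : ℝ) < n := by exact_mod_cast hn
  -- This is the minimiser of `x ^ (-m) * (1 - x) ^ (-n)`, the Chernoff-type bound for the count.
  set x : ℝ := m / (m + n) with hx
  have hx0 : 0 < x := by positivity
  have hx1 : x < 1 := by rw [hx, div_lt_one (by positivity)]; linarith
  have hx2 : (1 - x)⁻¹ = (m + n) / n := by
    rw [hx, one_sub_div (by positivity), inv_div, add_sub_cancel_left]
  have hxm : Real.exp (-n) ≤ x ^ m := by
    rw [Real.rpow_def_of_pos hx0, Real.exp_le_exp]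
    have hlog : -Real.log x ≤ n / m := by
      rw [← Real.log_inv]
      calc Real.log x⁻¹ ≤ x⁻¹ - 1 := Real.log_le_sub_one_of_pos (by positivity)
        _ = n / m := by rw [hx]; field_simp; ring
    have := mul_le_mul_of_nonneg_right hlog hm.le
    rw [div_mul_cancel₀ _ hm.ne'] at this
    linarith
  set A := Finset.univ.filter fun σ : Equiv.Perm (Fin n) => (permInversions σ : ℝ) ≤ m
  have h1 : (A.card : ℝ) * Real.exp (-n) ≤ ((m + n) / n) ^ n := by
    calc (A.card : ℝ) * Real.exp (-n) = ∑ σ ∈ A, Real.exp (-n) := by simp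
      _ ≤ ∑ σ ∈ A, x ^ permInversions σ := by
          refine Finset.sum_le_sum fun σ hσ => hxm.trans ?_
          rw [← Real.rpow_natCast]
          exact Real.rpow_le_rpow_of_exponent_ge hx0 hx1.le (Finset.mem_filter.1 hσ).2
      _ ≤ ∑ σ : Equiv.Perm (Fin n), x ^ permInversions σ :=
          Finset.sum_le_sum_of_subset_of_nonneg (Finset.subset_univ _) fun _ _ _ => by positivity
      _ ≤ _ := by rw [← hx2]; exact sum_pow_permInversions_le n hx0.le hx1
  rw [Real.exp_neg, ← div_eq_mul_inv, div_le_iff₀ (Real.exp_pos _)] at h1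
  rw [mul_pow, ← Real.exp_nat_mul, mul_one, mul_comm]
  exact h1

end Inversions

/-! ### The first-moment bound and non-existence. -/

section FirstMoment

open MeasureTheory

/-- Subadditivity alone gives `1 ≤ μ S + μ Sᶜ`, so the events need not be measurable. -/
lemma tendsto_measure_one_of_compl_le {Ω : ℕ → Type*} [∀ n, MeasurableSpace (Ω n)]
    (μ : ∀ n, Measure (Ω n)) [∀ n, IsProbabilityMeasure (μ n)] (S : ∀ n, Set (Ω n)) (δ : ℕ → ℝ)
    (hδ : Tendsto δ atTop (𝓝 0)) (h : ∀ᶠ n in atTop, (μ n).real (S n)ᶜ ≤ δ n) :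
    Tendsto (fun n => μ n (S n)) atTop (𝓝 1) := by
  have h1 : Tendsto (fun n => 1 - ENNReal.ofReal (δ n)) atTop (𝓝 1) := by
    have := ENNReal.Tendsto.sub (tendsto_const_nhds (x := (1 : ENNReal)))
      (ENNReal.tendsto_ofReal hδ) (Or.inl ENNReal.one_ne_top)
    simpa using this
  refine tendsto_of_tendsto_of_tendsto_of_le_of_le' h1 tendsto_const_nhds ?_
    (Eventually.of_forall fun n => prob_le_one)
  filter_upwards [h] with n hn
  rw [tsub_le_iff_right]
  calc (1 : ENNReal) = μ n (S n ∪ (S n)ᶜ) := by simp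
    _ ≤ μ n (S n) + μ n (S n)ᶜ := measure_union_le _ _
    _ ≤ μ n (S n) + ENNReal.ofReal (δ n) := by
        gcongr
        rw [← ENNReal.ofReal_toReal (measure_ne_top (μ n) (S n)ᶜ)]
        exact ENNReal.ofReal_le_ofReal hn

/-- Union bound over all permutations with at most `m` inversions, dropping the condition `σ 0 = 0`;
each cycle has `k + 3` distinct edges. -/
lemma binomialRandom_real_hasHamiltonCycle_le {k : ℕ} (p : unitInterval) {m : ℝ} (hm : 0 < m) :
    (SimpleGraph.binomialRandom (Fin (k + 3)) p).real
      {G | HasHamiltonCycleWithInversionsLE G m} ≤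
      (Real.exp 1 * ((m + (k + 3 : ℕ)) / (k + 3 : ℕ)) * p) ^ (k + 3) := by
  classical
  set A := Finset.univ.filter
    fun σ : Equiv.Perm (Fin (k + 3)) => (permInversions σ : ℝ) ≤ m with hA
  simp only [hasHamiltonCycleWithInversionsLE_iff]
  rw [binomialRandom_real_eq_binomialSum p (fun W => ∃ σ : Equiv.Perm (Fin (k + 3)), σ 0 = 0 ∧
      (permInversions σ : ℝ) ≤ m ∧ cycleEdges σ ⊆ W)]
  set u := Finset.univ.filter fun e : Sym2 (Fin (k + 3)) => ¬ e.IsDiag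
  calc _ ≤ binomialSum u p (fun W => ∑ σ ∈ A, if cycleEdges σ ⊆ W then (1 : ℝ) else 0) := by
        refine binomialSum_mono p.2.1 p.2.2 fun W _ => ?_
        split_ifs with h
        · obtain ⟨σ, -, h1, h2⟩ := h
          refine le_trans ?_ (Finset.single_le_sum (f := fun τ : Equiv.Perm (Fin (k + 3)) =>
            if cycleEdges τ ⊆ W then (1 : ℝ) else 0) (fun τ _ => ?_)
            (Finset.mem_filter.2 ⟨Finset.mem_univ σ, h1⟩))
          · rw [if_pos h2]
          · split_ifs <;> norm_num
        · exact Finset.sum_nonneg fun τ _ => by split_ifs <;> norm_num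
    _ = ∑ σ ∈ A, binomialSum u p (fun W => if cycleEdges σ ⊆ W then (1 : ℝ) else 0) := by
        simp only [binomialSum, Finset.mul_sum]
        rw [Finset.sum_comm]
    _ = ∑ σ ∈ A, (p : ℝ) ^ (k + 3) := by
        refine Finset.sum_congr rfl fun σ _ => ?_
        rw [binomialSum_superset (cycleEdges_subset σ), card_cycleEdges]
    _ = A.card * (p : ℝ) ^ (k + 3) := by simp
    _ ≤ _ := by
        rw [mul_pow _ (p : ℝ)]
        exact mul_le_mul_of_nonneg_right (card_permInversions_le (by omega) hm)
          (pow_nonneg p.2.1 _)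

theorem tendsto_not_hasHamiltonCycle (M : ℕ → ℝ) {c : ℝ} (hc : 0 < c)
    (hM : ∀ᶠ n : ℕ in atTop, c * ((n : ℝ) * Real.log (n : ℝ)) ≤ M n) {ε : ℝ} (hε : 0 < ε)
    (p : ℕ → unitInterval)
    (hp : ∀ᶠ n : ℕ in atTop, (p n : ℝ) ≤ (1 - ε) * (n : ℝ) / (Real.exp 1 * M n)) :
    Tendsto (fun n : ℕ => SimpleGraph.binomialRandom (Fin n) (p n)
      {G | ¬ HasHamiltonCycleWithInversionsLE G (M n)}) atTop (𝓝 1) := by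
  -- The base of the bound is at most `(1 - ε) (1 + n / M)`. Once `n / M ≤ ε` this is at most `1 - ε
  -- ^ 2` for `ε ≤ 1`, and nonpositive for `ε ≥ 1`.
  set ρ : ℝ := max (1 - ε ^ 2) 0 with hρ
  have hρ0 : 0 ≤ ρ := le_max_right _ _
  have hρ1 : ρ < 1 := max_lt (by nlinarith) one_pos
  refine tendsto_measure_one_of_compl_le _ _ (fun n => ρ ^ n)
    (tendsto_pow_atTop_nhds_zero_of_lt_one hρ0 hρ1) ?_
  have hlog : ∀ᶠ n : ℕ in atTop, 1 / (c * ε) ≤ Real.log (n : ℝ) :=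
    (Real.tendsto_log_atTop.comp tendsto_natCast_atTop_atTop).eventually_ge_atTop _
  filter_upwards [hM, hp, hlog, eventually_ge_atTop 3] with n hM hp hlog hn
  obtain ⟨k, rfl⟩ : ∃ k, n = k + 3 := ⟨n - 3, by omega⟩
  set n := k + 3 with hnk
  have hn0 : (0 : ℝ) < n := by positivity
  have hce : 0 < 1 / (c * ε) := by positivity
  have hM0 : 0 < M n := lt_of_lt_of_le (by have := hce.trans_le hlog; positivity) hM
  have hnM : (n : ℝ) / M n ≤ ε := by
    rw [div_le_iff₀ hM0]
    rw [div_le_iff₀ (by positivity)] at hlog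
    nlinarith
  have hset : ({G : SimpleGraph (Fin n) | ¬ HasHamiltonCycleWithInversionsLE G (M n)})ᶜ =
      {G | HasHamiltonCycleWithInversionsLE G (M n)} := by ext; simp
  rw [hset]
  refine (binomialRandom_real_hasHamiltonCycle_le (p n) hM0).trans ?_
  refine pow_le_pow_left₀ (mul_nonneg (by positivity) (p n).2.1) ?_ _
  calc Real.exp 1 * ((M n + n) / n) * (p n : ℝ)
      ≤ Real.exp 1 * ((M n + n) / n) * ((1 - ε) * n / (Real.exp 1 * M n)) :=
        mul_le_mul_of_nonneg_left hp (by positivity)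
    _ = (1 - ε) * (1 + n / M n) := by
        have := Real.exp_pos 1
        field_simp
    _ ≤ ρ := by
        have hpos : 0 ≤ (n : ℝ) / M n := by positivity
        rcases le_total ε 1 with h | h
        · refine le_trans ?_ (le_max_left _ _)
          nlinarith
        · refine le_trans ?_ (le_max_right _ _)
          nlinarith

end FirstMoment

/-! ### Encoding orders by ranks within blocks. -/

section Ranks

variable {α ι : Type*}

/-- The number of elements of `N` in the block of `v` whose position is before that of `v`. -/
def blockRank (N : Finset α) (b : α → ℕ) (pos : α → ℕ) (v : α) : ℕ :=
  (N.filter fun w => b w = b v ∧ pos w < pos v).card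

lemma blockRank_lt {N : Finset α} {b pos : α → ℕ} {v : α} (hv : v ∈ N) :
    blockRank N b pos v < (N.filter fun w => b w = b v).card := by
  refine Finset.card_lt_card ⟨fun w hw => ?_, fun h => ?_⟩
  · simp only [Finset.mem_filter] at hw ⊢
    exact ⟨hw.1, hw.2.1⟩
  · have := @h v (by simp [hv])
    simp at this

lemma blockRank_lt_blockRank {N : Finset α} {b pos : α → ℕ} {v w : α} (hv : v ∈ N)
    (hb : b v = b w) (h : pos v < pos w) : blockRank N b pos v < blockRank N b pos w := by
  refine Finset.card_lt_card ⟨fun x hx => ?_, fun h' => ?_⟩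
  · simp only [Finset.mem_filter] at hx ⊢
    exact ⟨hx.1, hx.2.1.trans hb, hx.2.2.trans h⟩
  · have := @h' v (by simp [hv, hb, h])
    simp at this

lemma eq_of_blockRank_eq {N : Finset α} {b pos : α → ℕ} (hpos : Function.Injective pos) {v w : α}
    (hv : v ∈ N) (hw : w ∈ N) (hb : b v = b w) (h : blockRank N b pos v = blockRank N b pos w) :
    v = w := by
  rcases lt_trichotomy (pos v) (pos w) with h' | h' | h'
  · exact absurd h (blockRank_lt_blockRank hv hb h').ne
  · exact hpos h'
  · exact absurd h (blockRank_lt_blockRank hw hb.symm h').ne'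

/-- The permutations of `N` respecting the blocks of `b`. -/
lemma card_blockPreserving [DecidableEq α] (N : Finset α) (b : α → ℕ) {J : Finset ℕ} (hJ : N.image b ⊆ J) :
    Fintype.card {g : Equiv.Perm N // (fun v : N => b v) ∘ g = fun v : N => b v} =
      ∏ j ∈ J, ((N.filter fun v => b v = j).card).factorial := by
  rw [DomMulAct.stabilizer_card']
  have hcard : ∀ j, Fintype.card {a : N // b a = j} = (N.filter fun v => b v = j).card := by
    intro j
    rw [Fintype.card_subtype]
    refine Finset.card_bij (fun a _ => a.1) ?_ (fun a _ b _ h => Subtype.ext h) ?_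
    · intro a ha
      simpa using ha
    · intro a ha
      rw [Finset.mem_filter] at ha
      exact ⟨⟨a, ha.1⟩, by simp [ha.2], rfl⟩
  simp only [hcard]
  refine Finset.prod_subset ?_ ?_
  · intro j hj
    obtain ⟨v, -, rfl⟩ := Finset.mem_image.1 hj
    exact hJ (Finset.mem_image_of_mem _ v.2)
  · intro j _ hj
    rw [Finset.card_eq_zero.2, Nat.factorial_zero]
    rw [Finset.filter_eq_empty_iff]
    intro v hv h
    exact hj (Finset.mem_image.2 ⟨⟨v, hv⟩, Finset.mem_univ _, h⟩)

/-- Within each block the ranks enumerate the members of `N` exactly once. After a fixed enumeration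
of every block, the ranks of `τ` become a block-preserving permutation of `N`, and these are counted
by the product of factorials. -/
lemma card_le_prod_factorial_of_blockRank [DecidableEq α] [Nonempty α] (N : Finset α) (b : α → ℕ) {J : Finset ℕ}
    (hJ : N.image b ⊆ J) (Φ : Finset ι) (pos : ι → α → ℕ)
    (hpos : ∀ τ, Function.Injective (pos τ))
    (hΦ : ∀ τ ∈ Φ, ∀ τ' ∈ Φ,
      (∀ v ∈ N, blockRank N b (pos τ) v = blockRank N b (pos τ') v) → τ = τ') :
    Φ.card ≤ ∏ j ∈ J, ((N.filter fun v => b v = j).card).factorial := by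
  have hen : ∀ j : ℕ, ∃ e : ℕ → α, (∀ r < (N.filter fun v => b v = j).card,
      e r ∈ N.filter fun v => b v = j) ∧
      Set.InjOn e {r | r < (N.filter fun v => b v = j).card} := by
    intro j
    set B := N.filter fun v => b v = j
    refine ⟨fun r => if h : r < B.card then (B.equivFin.symm ⟨r, h⟩ : α)
      else Classical.arbitrary α, fun r hr => ?_, fun r hr r' hr' h => ?_⟩
    · simp only [dif_pos hr]; exact (B.equivFin.symm ⟨r, hr⟩).2
    · simp only [Set.mem_ofPred_eq] at hr hr'
      simp only [dif_pos hr, dif_pos hr'] at h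
      have := B.equivFin.symm.injective (Subtype.ext h)
      simpa using this
  choose e he hinj using hen
  have hg : ∀ τ, ∃ g : Equiv.Perm N, ((fun v : N => b v) ∘ g = fun v : N => b v) ∧
      ∀ v : N, (g v : α) = e (b v) (blockRank N b (pos τ) v) := by
    intro τ
    have hmem : ∀ v : N, e (b v) (blockRank N b (pos τ) v) ∈ N.filter fun w => b w = b v :=
      fun v => he _ _ (blockRank_lt v.2)
    set f : N → N := fun v => ⟨_, (Finset.mem_filter.1 (hmem v)).1⟩ with hf
    have hfb : ∀ v, b (f v) = b v := fun v => (Finset.mem_filter.1 (hmem v)).2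
    have hfi : Function.Injective f := by
      intro v w h
      have hb : b v = b w := by rw [← hfb v, h, hfb]
      have h' : e (b v) (blockRank N b (pos τ) v) = e (b v) (blockRank N b (pos τ) w) := by
        have := congrArg Subtype.val h
        simp only [hf] at this
        rw [this, hb]
      have := hinj (b v) (blockRank_lt v.2) (by
        have := blockRank_lt (b := b) (pos := pos τ) w.2
        rwa [← hb] at this) h'
      exact Subtype.ext (eq_of_blockRank_eq (hpos τ) v.2 w.2 hb this)
    exact ⟨Equiv.ofBijective f (Finite.injective_iff_bijective.1 hfi), funext hfb, fun v => rfl⟩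
  choose g hgb hge using hg
  rw [← card_blockPreserving N b hJ, ← Finset.card_univ]
  refine Finset.card_le_card_of_injOn (fun τ => ⟨g τ, hgb τ⟩) (fun _ _ => by simp) ?_
  intro τ hτ τ' hτ' h
  refine hΦ τ hτ τ' hτ' fun v hv => ?_
  have h1 : g τ = g τ' := congrArg Subtype.val h
  have h2 := hge τ ⟨v, hv⟩
  rw [h1, hge τ'] at h2
  exact (hinj _ (blockRank_lt hv) (blockRank_lt hv) h2).symm

end Ranks

/-! ### Comparing factorials. -/

section FactorialBounds

lemma factorial_mul_pow_le (k t : ℕ) :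
    (k.factorial : ℝ) * ((k + t : ℕ) : ℝ) ^ t ≤ Real.exp 1 ^ t * ((k + t).factorial : ℝ) := by
  induction t with
  | zero => simp
  | succ t ih =>
    have h1 : (((k + t + 1 : ℕ) : ℝ)) ^ t ≤ Real.exp 1 * ((k + t : ℕ) : ℝ) ^ t := by
      rcases Nat.eq_zero_or_pos (k + t) with h0 | h0
      · obtain rfl : t = 0 := by omega
        simp
      · have hx : (0 : ℝ) < (k + t : ℕ) := by exact_mod_cast h0
        have h2 : ((k + t + 1 : ℕ) : ℝ) ≤ Real.exp (1 / (k + t : ℕ)) * (k + t : ℕ) := by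
          have := Real.add_one_le_exp (1 / ((k + t : ℕ) : ℝ))
          calc ((k + t + 1 : ℕ) : ℝ) = (1 / ((k + t : ℕ) : ℝ) + 1) * (k + t : ℕ) := by
                field_simp; push_cast; ring
            _ ≤ _ := mul_le_mul_of_nonneg_right this hx.le
        calc (((k + t + 1 : ℕ) : ℝ)) ^ t ≤ (Real.exp (1 / (k + t : ℕ)) * (k + t : ℕ)) ^ t :=
              pow_le_pow_left₀ (by positivity) h2 _
          _ = Real.exp (t * (1 / (k + t : ℕ))) * ((k + t : ℕ) : ℝ) ^ t := by
              rw [mul_pow, Real.exp_nat_mul]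
          _ ≤ _ := by
              refine mul_le_mul_of_nonneg_right (Real.exp_le_exp.2 ?_) (by positivity)
              rw [mul_one_div, div_le_one hx]
              exact_mod_cast Nat.le_add_left t k
    rw [← add_assoc, Nat.factorial_succ]
    push_cast at h1 ih ⊢
    have hk : (0 : ℝ) ≤ k + t + 1 := by positivity
    calc (k.factorial : ℝ) * ((k : ℝ) + t + 1) ^ (t + 1)
        = (k.factorial * ((k : ℝ) + t + 1) ^ t) * (k + t + 1) := by ring
      _ ≤ (k.factorial * (Real.exp 1 * ((k : ℝ) + t) ^ t)) * (k + t + 1) := by gcongr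
      _ = (k.factorial * ((k : ℝ) + t) ^ t) * (Real.exp 1 * (k + t + 1)) := by ring
      _ ≤ (Real.exp 1 ^ t * ((k + t).factorial : ℝ)) * (Real.exp 1 * (k + t + 1)) := by gcongr
      _ = _ := by ring

/-- Each element removed from a block of size `c ≥ m` saves a factor `m / e` in the factorial,
uniformly in how many are removed, even when the whole block goes. -/
lemma factorial_le_mul_pow {a c : ℕ} (h : a ≤ c) {m : ℝ} (hm : 0 < m) (hmc : m ≤ c) :
    (a.factorial : ℝ) ≤ c.factorial * (Real.exp 1 / m) ^ (c - a) := by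
  obtain ⟨t, rfl⟩ := Nat.exists_eq_add_of_le h
  rw [Nat.add_sub_cancel_left, div_pow, mul_div_assoc', le_div_iff₀ (by positivity)]
  calc (a.factorial : ℝ) * m ^ t ≤ a.factorial * ((a + t : ℕ) : ℝ) ^ t := by gcongr
    _ ≤ _ := (factorial_mul_pow_le a t).trans (le_of_eq (mul_comm _ _))

end FactorialBounds

/-! ### Block-preserving permutations with prescribed adjacencies. -/

section BlockPerms

/-- The permutations mapping every block of `b` to itself. -/
def blockPerms {n : ℕ} (b : Fin n → ℕ) : Finset (Equiv.Perm (Fin n)) :=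
  Finset.univ.filter fun σ => ∀ i, b (σ i) = b i

lemma mem_blockPerms {n : ℕ} {b : Fin n → ℕ} {σ : Equiv.Perm (Fin n)} :
    σ ∈ blockPerms b ↔ ∀ i, b (σ i) = b i := by
  simp [blockPerms]

lemma card_blockPerms {n : ℕ} (b : Fin n → ℕ) :
    (blockPerms b).card = ∏ j ∈ Finset.univ.image b,
      ((Finset.univ.filter fun v => b v = j).card).factorial := by
  have h := DomMulAct.stabilizer_card' b
  simp only [Fintype.card_subtype] at h
  rw [← h, blockPerms]
  congr 1
  refine Finset.filter_congr fun σ _ => ?_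
  exact ⟨fun h => funext h, fun h i => congrFun h i⟩

/-- The block-preserving permutations in which `π (i + 1)` directly follows `π i` for `i ∈ I`. -/
def followers {k : ℕ} (b : Fin (k + 1) → ℕ) (π : Equiv.Perm (Fin (k + 1)))
    (I : Finset (Fin (k + 1))) : Finset (Equiv.Perm (Fin (k + 1))) :=
  (blockPerms b).filter fun τ => ∀ i ∈ I, τ (τ.symm (π i) + 1) = π (i + 1)

variable {k : ℕ} {b : Fin (k + 1) → ℕ} {π : Equiv.Perm (Fin (k + 1))} {I : Finset (Fin (k + 1))}

lemma blockPerms_zero (h0 : ∀ v, b v = b 0 → v = 0) {τ : Equiv.Perm (Fin (k + 1))}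
    (hτ : τ ∈ blockPerms b) : τ 0 = 0 :=
  h0 _ (mem_blockPerms.1 hτ 0)

/-- A follower is reconstructed from left to right. A vertex outside `N` is either forced by its
predecessor, already placed, or pinned to one position. A free vertex has its block known from the
position and its rank known from the prefix. The ranks on `N` therefore determine everything. -/
lemma followers_eq_of_blockRank (h0 : ∀ v, b v = b 0 → v = 0) (hπ : π ∈ blockPerms b)
    {N : Finset (Fin (k + 1))}
    (hN : ∀ j, π j ∈ N ∨ (∃ i ∈ I, i ≠ Fin.last k ∧ j = i + 1) ∨
      ∀ τ ∈ followers b π I, τ j = π j)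
    {τ τ' : Equiv.Perm (Fin (k + 1))} (hτ : τ ∈ followers b π I) (hτ' : τ' ∈ followers b π I)
    (hrank : ∀ v ∈ N, blockRank N b (fun w => (τ.symm w : ℕ)) v =
      blockRank N b (fun w => (τ'.symm w : ℕ)) v) : τ = τ' := by
  have step : ∀ {τ τ' : Equiv.Perm (Fin (k + 1))}, τ ∈ followers b π I → τ' ∈ followers b π I →
      ∀ l, (∀ l' < l, τ l' = τ' l') → τ l ∉ N → τ l = τ' l := by
    intro τ τ' hτ hτ' l ih hl
    obtain ⟨j, hj⟩ := π.surjective (τ l)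
    rcases hN j with h | ⟨i, hi, hne, rfl⟩ | h
    · rw [hj] at h; exact absurd h hl
    · have e1 := (Finset.mem_filter.1 hτ).2 i hi
      have e2 := (Finset.mem_filter.1 hτ').2 i hi
      have e3 : τ.symm (π i) + 1 = l := τ.injective (e1.trans hj)
      -- Adjacency is cyclic, so left-to-right reconstruction needs the predecessor not to sit at
      -- the last position.
      have hlast : τ.symm (π i) ≠ Fin.last k := by
        intro h
        rw [h, Fin.last_add_one] at e3
        rw [← e3, blockPerms_zero h0 (Finset.mem_filter.1 hτ).1,
          ← blockPerms_zero h0 hπ] at hj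
        have := π.injective hj
        rw [← Fin.last_add_one k] at this
        exact hne (add_right_cancel this)
      have hlt : τ.symm (π i) < l := by
        rw [← e3, Fin.lt_def, Fin.val_add_one_of_lt (Fin.lt_last_iff_ne_last.2 hlast)]
        omega
      have h1 := ih _ hlt
      rw [Equiv.apply_symm_apply] at h1
      have h2 : τ'.symm (π i) = τ.symm (π i) := by rw [h1, Equiv.symm_apply_apply]; rw [← h1]
      rw [h2, e3] at e2
      rw [e2, hj]
    · have : j = l := τ.injective ((h τ hτ).trans hj)
      subst this
      rw [h τ' hτ', hj]
  have main : ∀ m : ℕ, ∀ l : Fin (k + 1), (l : ℕ) = m → τ l = τ' l := by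
    intro m
    induction m using Nat.strong_induction_on with
    | _ m ih =>
      intro l hl
      have ih' : ∀ l' < l, τ l' = τ' l' := fun l' hl' => ih l' (by rw [← hl]; exact hl') l' rfl
      by_cases h1 : τ l ∈ N
      · by_cases h2 : τ' l ∈ N
        · have hb1 := mem_blockPerms.1 (Finset.mem_filter.1 hτ).1 l
          have hb2 := mem_blockPerms.1 (Finset.mem_filter.1 hτ').1 l
          have hsymm : ∀ w, τ.symm w < l ↔ τ'.symm w < l := by
            intro w
            constructor
            · intro h
              have := ih' _ h
              rw [Equiv.apply_symm_apply] at this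
              rwa [this, Equiv.symm_apply_apply]
            · intro h
              have := ih' _ h
              rw [Equiv.apply_symm_apply] at this
              rwa [← this, Equiv.symm_apply_apply]
          have hr : blockRank N b (fun w => (τ.symm w : ℕ)) (τ l) =
              blockRank N b (fun w => (τ'.symm w : ℕ)) (τ' l) := by
            unfold blockRank
            congr 1
            refine Finset.filter_congr fun w _ => ?_
            simp only [Equiv.symm_apply_apply, hb1, hb2, ← Fin.lt_def, hsymm]
          rw [← hrank _ h2] at hr
          exact eq_of_blockRank_eq (Fin.val_injective.comp τ.symm.injective) h1 h2
            (hb1.trans hb2.symm) hr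
        · exact (step hτ' hτ l (fun l' hl' => (ih' l' hl').symm) h2).symm
      · exact step hτ hτ' l ih' h1
  exact Equiv.ext fun l => main l l rfl

/-- Followers inject into rank patterns on `N`. Comparing factorials block by block, every vertex
outside `N` contributes a factor `e / m`; the block `{0}`, possibly shorter than `m`, lies inside
`N` and loses nothing. -/
lemma card_followers_le_of_free {m : ℝ} (hm : 0 < m) (h0 : ∀ v, b v = b 0 → v = 0)
    (hb : ∀ v, b v ≠ b 0 → m ≤ (Finset.univ.filter fun w => b w = b v).card)
    (hπ : π ∈ blockPerms b) {N : Finset (Fin (k + 1))} (h0N : 0 ∈ N)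
    (hN : ∀ j, π j ∈ N ∨ (∃ i ∈ I, i ≠ Fin.last k ∧ j = i + 1) ∨
      ∀ τ ∈ followers b π I, τ j = π j) :
    ((followers b π I).card : ℝ) ≤
      (blockPerms b).card * (Real.exp 1 / m) ^ (Nᶜ.card) := by
  have h1 := card_le_prod_factorial_of_blockRank N b (J := Finset.univ.image b)
    (Finset.image_subset_image (Finset.subset_univ _)) (followers b π I)
    (fun τ w => (τ.symm w : ℕ)) (fun τ => Fin.val_injective.comp τ.symm.injective)
    (fun τ hτ τ' hτ' h => followers_eq_of_blockRank h0 hπ hN hτ hτ' h)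
  have hsum : Nᶜ.card = ∑ j ∈ Finset.univ.image b,
      ((Finset.univ.filter fun v => b v = j).card - (N.filter fun v => b v = j).card) := by
    rw [Finset.card_eq_sum_card_image b Nᶜ]
    rw [← Finset.sum_subset (Finset.image_subset_image (Finset.subset_univ Nᶜ)) (f := fun j =>
      (Finset.univ.filter fun v => b v = j).card - (N.filter fun v => b v = j).card)]
    · refine Finset.sum_congr rfl fun j _ => ?_
      rw [← Finset.card_sdiff_of_subset (Finset.filter_subset_filter _ (Finset.subset_univ N))]
      congr 1
      ext v
      simp only [Finset.mem_filter, Finset.mem_compl, Finset.mem_sdiff, Finset.mem_univ, true_and]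
      tauto
    · intro j _ hj
      rw [Nat.sub_eq_zero_iff_le]
      refine Finset.card_le_card fun v hv => ?_
      simp only [Finset.mem_filter, Finset.mem_univ, true_and] at hv ⊢
      refine ⟨?_, hv⟩
      by_contra h
      exact hj (Finset.mem_image.2 ⟨v, Finset.mem_compl.2 h, hv⟩)
  rw [hsum, ← Finset.prod_pow_eq_pow_sum, card_blockPerms]
  refine le_trans (Nat.cast_le.2 h1) ?_
  push_cast
  rw [← Finset.prod_mul_distrib]
  refine Finset.prod_le_prod (fun _ _ => by positivity) fun j hj => ?_
  obtain ⟨v, -, rfl⟩ := Finset.mem_image.1 hj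
  have hle := Finset.card_le_card
    (Finset.filter_subset_filter (fun w => b w = b v) (Finset.subset_univ N))
  by_cases hv : b v = b 0
  · have hc : (Finset.univ.filter fun w => b w = b v) = N.filter fun w => b w = b v := by
      ext w
      simp only [Finset.mem_filter, Finset.mem_univ, true_and, hv]
      exact ⟨fun h => ⟨by rw [h0 w h]; exact h0N, h⟩, fun h => h.2⟩
    rw [hc]
    simp
  · exact factorial_le_mul_pow hle hm (hb v hv)

/-- Prescribing `|I|` adjacencies costs a factor of order `m` each. -/
lemma card_followers_le {m : ℕ} (hm : 0 < m) (h0 : ∀ v, b v = b 0 → v = 0)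
    (hb : ∀ v, b v ≠ b 0 → m ≤ (Finset.univ.filter fun w => b w = b v).card)
    (hmono : Monotone b) (hlast : b (Fin.last k) ≠ b 0) (hπ : π ∈ blockPerms b) :
    ((followers b π I).card : ℝ) ≤
      (blockPerms b).card * (2 * Real.exp 1 / m) ^ I.card := by
  have hm' : (0 : ℝ) < m := by exact_mod_cast hm
  have he := Real.exp_pos 1
  have hb' : ∀ v, b v ≠ b 0 → (m : ℝ) ≤ (Finset.univ.filter fun w => b w = b v).card :=
    fun v hv => by exact_mod_cast hb v hv
  -- `T` collects the forced successors. The adjacency closing the cycle is left out, because its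
  -- successor 0 is fixed anyway; when prescribed, it must yield its factor in another way.
  set T := (I.erase (Fin.last k)).image fun i => π (i + 1) with hT
  have hTcard : T.card = (I.erase (Fin.last k)).card :=
    Finset.card_image_of_injective _ fun i j h => add_right_cancel (π.injective h)
  have hmemT : ∀ {j}, π j ∈ T → ∃ i ∈ I, i ≠ Fin.last k ∧ j = i + 1 := by
    intro j hj
    obtain ⟨i, hi, h⟩ := Finset.mem_image.1 hj
    exact ⟨i, Finset.mem_of_mem_erase hi, Finset.ne_of_mem_erase hi, (π.injective h).symm⟩
  have hπ0 := blockPerms_zero h0 hπ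
  have h0T : (0 : Fin (k + 1)) ∉ T := by
    intro h
    rw [← hπ0] at h
    obtain ⟨i, -, hne, h⟩ := hmemT h
    rw [← Fin.last_add_one k] at h
    exact hne (add_right_cancel h).symm
  have hweak : (Real.exp 1 / m) ^ I.card ≤ (2 * Real.exp 1 / m) ^ I.card := by
    gcongr
    linarith
  by_cases hI : Fin.last k ∈ I
  · have hIcard : (I.erase (Fin.last k)).card + 1 = I.card := Finset.card_erase_add_one hI
    by_cases hfree : ∃ j, b j = b (Fin.last k) ∧ π j ∉ T
    · obtain ⟨p, hp, hmax⟩ := Finset.exists_max_image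
        (Finset.univ.filter fun j => b j = b (Fin.last k) ∧ π j ∉ T) id
        (by obtain ⟨j, hj⟩ := hfree; exact ⟨j, by simp [hj]⟩)
      simp only [Finset.mem_filter, Finset.mem_univ, true_and, id] at hp hmax
      have hafter : ∀ j, p < j → π j ∈ T := by
        intro j hj
        by_contra h
        refine absurd (hmax j ⟨le_antisymm (hmono (Fin.le_last j)) ?_, h⟩) (not_le.2 hj)
        rw [← hp.1]
        exact hmono hj.le
      have hagree : ∀ τ ∈ followers b π I, ∀ d : ℕ, ∀ j : Fin (k + 1), (j : ℕ) + d = k → p ≤ j →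
          τ j = π j := by
        intro τ hτ d
        have hτ0 := blockPerms_zero h0 (Finset.mem_filter.1 hτ).1
        induction d with
        | zero =>
          intro j hj _
          obtain rfl : j = Fin.last k := Fin.ext (by simpa using hj)
          have := (Finset.mem_filter.1 hτ).2 _ hI
          rw [Fin.last_add_one, hπ0, ← hτ0] at this
          have := τ.injective this
          rw [← Fin.last_add_one k] at this
          exact (τ.symm_apply_eq.1 (add_right_cancel this)).symm
        | succ d ih =>
          intro j hj hpj
          have hjl : j < Fin.last k := by rw [Fin.lt_def, Fin.val_last]; omega
          have hv := Fin.val_add_one_of_lt hjl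
          have hlt : j < j + 1 := by rw [Fin.lt_def, hv]; omega
          have h1 := ih (j + 1) (by rw [hv]; omega) (hpj.trans hlt.le)
          obtain ⟨i, hi, -, hij⟩ := hmemT (hafter (j + 1) (lt_of_le_of_lt hpj hlt))
          obtain rfl := add_right_cancel hij
          have h2 := (Finset.mem_filter.1 hτ).2 _ hi
          rw [← h1] at h2
          have h3 := add_right_cancel (τ.injective h2)
          rw [← h3, Equiv.apply_symm_apply, h3]
      have hp0 : π p ≠ 0 := by
        intro h
        rw [← hπ0] at h
        rw [π.injective h] at hp
        exact hlast hp.1.symm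
      have hmain := card_followers_le_of_free (I := I) hm' h0 hb' hπ (N := (insert (π p) T)ᶜ)
        (by simp [h0T, hp0.symm]) (by
          intro j
          by_cases hjp : j = p
          · subst hjp
            exact Or.inr (Or.inr fun τ hτ => hagree τ hτ (k - j) j (by omega) le_rfl)
          · by_cases hjT : π j ∈ T
            · exact Or.inr (Or.inl (hmemT hjT))
            · left
              simp [hjT, hjp])
      rw [compl_compl, Finset.card_insert_of_notMem hp.2, hTcard, hIcard] at hmain
      exact hmain.trans (mul_le_mul_of_nonneg_left hweak (by positivity))
    · push Not at hfree
      -- The final block is entirely forced, so `T` has at least `m` elements. The missing factor of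
      -- order `1 / m` is then absorbed by `2 ^ |T| ≥ m`, which is the reason for `2e` in place of
      -- `e`.
      have hmT : m ≤ T.card := by
        refine (hb _ hlast).trans ?_
        rw [← Finset.card_image_of_injective _ π.injective]
        refine Finset.card_le_card fun v hv => ?_
        obtain ⟨j, hj, rfl⟩ := Finset.mem_image.1 hv
        exact hfree j (Finset.mem_filter.1 hj).2
      have hmain := card_followers_le_of_free (I := I) hm' h0 hb' hπ (N := Tᶜ)
        (by simpa using h0T) (by
          intro j
          by_cases hjT : π j ∈ T
          · exact Or.inr (Or.inl (hmemT hjT))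
          · left; simpa using hjT)
      rw [compl_compl] at hmain
      refine hmain.trans (mul_le_mul_of_nonneg_left ?_ (by positivity))
      rw [← hIcard, ← hTcard]
      set t := T.card
      have h2t : (m : ℝ) ≤ 2 ^ t := by
        exact_mod_cast (Nat.lt_two_pow_self (n := m)).le.trans (Nat.pow_le_pow_right (by norm_num) hmT)
      calc (Real.exp 1 / m) ^ t = (Real.exp 1 / m) ^ t * 1 := (mul_one _).symm
        _ ≤ (Real.exp 1 / m) ^ t * (2 ^ t * (2 * Real.exp 1 / m)) := by
            refine mul_le_mul_of_nonneg_left ?_ (by positivity)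
            have h1 : 1 ≤ 2 * Real.exp 1 := by linarith [Real.exp_one_gt_two]
            calc (1 : ℝ) = m * (1 / m) := by field_simp
              _ ≤ 2 ^ t * (2 * Real.exp 1 / m) := by gcongr
        _ = (2 * Real.exp 1 / m) ^ (t + 1) := by
            rw [pow_succ, mul_div_assoc, mul_pow]; ring
  · have hmain := card_followers_le_of_free (I := I) hm' h0 hb' hπ (N := Tᶜ)
      (by simpa using h0T) (by
        intro j
        by_cases hjT : π j ∈ T
        · exact Or.inr (Or.inl (hmemT hjT))
        · left; simpa using hjT)
    rw [compl_compl, hTcard, Finset.erase_eq_of_notMem hI] at hmain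
    exact hmain.trans (mul_le_mul_of_nonneg_left hweak (by positivity))

end BlockPerms

/-! ### Spreadness of the block-preserving cycles, and the blocks. -/

section CycleSpread

variable {k : ℕ} {b : Fin (k + 3) → ℕ}

/-- The Hamilton cycles of block-preserving permutations form a `4e/m`-spread hypergraph. -/
lemma card_subset_cycleEdges_le {m : ℕ} (hm : 0 < m) (h0 : ∀ v, b v = b 0 → v = 0)
    (hb : ∀ v, b v ≠ b 0 → m ≤ (Finset.univ.filter fun w => b w = b v).card)
    (hmono : Monotone b) (hlast : b (Fin.last (k + 2)) ≠ b 0) (S : Finset (Sym2 (Fin (k + 3)))) :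
    (((blockPerms b).filter fun σ => S ⊆ cycleEdges σ).card : ℝ) ≤
      (blockPerms b).card * (4 * Real.exp 1 / m) ^ S.card := by
  classical
  -- `D σ` records which edges of `S` are traversed upwards. Fixing it, at a cost of `2 ^ |S|`,
  -- turns undirected edges into prescribed successors, so each fibre lies in the followers of any
  -- one of its members.
  set D : Equiv.Perm (Fin (k + 3)) → Finset (Sym2 (Fin (k + 3))) := fun σ =>
    S.filter fun e => ∃ i, s(σ i, σ (i + 1)) = e ∧ σ i < σ (i + 1) with hD
  have hmemD : ∀ σ i, s(σ i, σ (i + 1)) ∈ S → (s(σ i, σ (i + 1)) ∈ D σ ↔ σ i < σ (i + 1)) := by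
    intro σ i hi
    simp only [hD, Finset.mem_filter]
    constructor
    · rintro ⟨-, j, hj, hlt⟩
      obtain rfl := cycleEdge_injective σ hj
      exact hlt
    · exact fun h => ⟨hi, i, rfl, h⟩
  set A := (blockPerms b).filter fun σ => S ⊆ cycleEdges σ with hA
  have hfiber : ∀ O ∈ S.powerset, ((A.filter fun σ => D σ = O).card : ℝ) ≤
      (blockPerms b).card * (2 * Real.exp 1 / m) ^ S.card := by
    intro O _
    rcases (A.filter fun σ => D σ = O).eq_empty_or_nonempty with h | ⟨π, hπ⟩
    · rw [h]
      simp only [Finset.card_empty, Nat.cast_zero]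
      positivity
    obtain ⟨hπA, hπO⟩ := Finset.mem_filter.1 hπ
    obtain ⟨hπb, hπS⟩ := Finset.mem_filter.1 hπA
    set I := Finset.univ.filter fun i => s(π i, π (i + 1)) ∈ S with hI
    have hIS : I.card = S.card := by
      rw [← Finset.card_image_of_injective I (cycleEdge_injective π)]
      congr 1
      ext e
      constructor
      · intro he
        obtain ⟨i, hi, rfl⟩ := Finset.mem_image.1 he
        exact (Finset.mem_filter.1 hi).2
      · intro he
        obtain ⟨i, -, rfl⟩ := Finset.mem_image.1 (hπS he)
        exact Finset.mem_image.2 ⟨i, Finset.mem_filter.2 ⟨Finset.mem_univ _, he⟩, rfl⟩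
    rw [← hIS]
    refine le_trans (Nat.cast_le.2 (Finset.card_le_card fun τ hτ => ?_))
      (card_followers_le (k := k + 2) hm h0 hb hmono hlast hπb)
    obtain ⟨hτA, hτO⟩ := Finset.mem_filter.1 hτ
    obtain ⟨hτb, hτS⟩ := Finset.mem_filter.1 hτA
    refine Finset.mem_filter.2 ⟨hτb, fun i hi => ?_⟩
    have hiS := (Finset.mem_filter.1 hi).2
    obtain ⟨j, -, hj⟩ := Finset.mem_image.1 (hτS hiS)
    rcases Sym2.eq_iff.1 hj with ⟨h1, h2⟩ | ⟨h1, h2⟩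
    · rw [← h1, Equiv.symm_apply_apply, h2]
    · exfalso
      have e1 := hmemD π i hiS
      have e2 := hmemD τ j (hj ▸ hiS)
      rw [hj, hτO, ← hπO, e1, h1, h2] at e2
      rcases lt_or_gt_of_ne (show π i ≠ π (i + 1) from fun h => by
        have := congrArg Fin.val (left_eq_add.1 (π.injective h))
        simp at this) with h | h
      · exact absurd h (e2.1 h).asymm
      · exact absurd h (e2.2 h).asymm
  have hcard : (A.card : ℝ) = ∑ O ∈ S.powerset, ((A.filter fun σ => D σ = O).card : ℝ) := by
    exact_mod_cast Finset.card_eq_sum_card_fiberwise (f := D) fun σ _ =>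
      Finset.mem_powerset.2 (Finset.filter_subset _ _)
  calc (A.card : ℝ) ≤ ∑ O ∈ S.powerset,
        ((blockPerms b).card * (2 * Real.exp 1 / m) ^ S.card : ℝ) := by
        rw [hcard]
        exact Finset.sum_le_sum hfiber
    _ = (blockPerms b).card * (4 * Real.exp 1 / m) ^ S.card := by
        rw [Finset.sum_const, Finset.card_powerset, nsmul_eq_mul]
        push_cast
        rw [mul_left_comm, ← mul_pow]
        congr 2
        ring

/-- Positions and values carry the same block labels, and the labels are monotone, so both entries
of an inversion lie in one block. -/
lemma permInversions_le_of_blockPerms {n s : ℕ} {b : Fin n → ℕ} (hmono : Monotone b)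
    (hs : ∀ v, (Finset.univ.filter fun w => b w = b v).card ≤ s) {σ : Equiv.Perm (Fin n)}
    (hσ : σ ∈ blockPerms b) : permInversions σ ≤ n * s := by
  rw [mem_blockPerms] at hσ
  calc permInversions σ ≤ (Finset.univ.filter fun q : Fin n × Fin n => b q.2 = b q.1).card := by
        refine Finset.card_le_card fun q hq => ?_
        simp only [Finset.mem_filter, Finset.mem_univ, true_and] at hq ⊢
        refine le_antisymm ?_ (hmono hq.1.le)
        rw [← hσ q.2, ← hσ q.1]
        exact hmono hq.2.le
    _ = ∑ v : Fin n, (Finset.univ.filter fun w => b w = b v).card := by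
        simp only [Finset.card_filter]
        rw [Fintype.sum_prod_type]
    _ ≤ ∑ _v : Fin n, s := Finset.sum_le_sum fun v _ => hs v
    _ = n * s := by simp

/-- A partition of `{0, …, n - 1}` into `{0}` and intervals of lengths between `m` and `2m`. -/
lemma exists_blocks {m : ℕ} (hm : 0 < m) (hmk : m ≤ k + 2) :
    ∃ b : Fin (k + 3) → ℕ, Monotone b ∧ (∀ v, b v = b 0 → v = 0) ∧
      (∀ v, b v ≠ b 0 → m ≤ (Finset.univ.filter fun w => b w = b v).card) ∧
      ∀ v, (Finset.univ.filter fun w => b w = b v).card ≤ 2 * m := by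
  set q := (k + 2) / m with hq
  have hq1 : 1 ≤ q := (Nat.one_le_div_iff hm).2 hmk
  have hqm : q * m ≤ k + 2 := Nat.div_mul_le_self _ _
  have hqm' : k + 2 < (q + 1) * m := Nat.lt_mul_of_div_lt (Nat.lt_succ_self _) hm
  -- Capping the index at `q - 1` merges the remainder, shorter than `m`, into the last full
  -- interval. The vertex 0 is kept apart so that block-preserving permutations start at 0.
  set b : Fin (k + 3) → ℕ := fun v =>
    if (v : ℕ) = 0 then 0 else 1 + min (((v : ℕ) - 1) / m) (q - 1) with hbdef
  have hb0 : b 0 = 0 := by simp [hbdef]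
  have hbne : ∀ v : Fin (k + 3), (v : ℕ) ≠ 0 → b v = 1 + min (((v : ℕ) - 1) / m) (q - 1) :=
    fun v hv => by simp only [hbdef, if_neg hv]
  have hzero : ∀ v, b v = b 0 → v = 0 := by
    intro v hv
    by_contra hne
    have hne' : (v : ℕ) ≠ 0 := fun h => hne (Fin.ext h)
    rw [hb0, hbne v hne'] at hv
    simp at hv
  refine ⟨b, ?_, hzero, ?_, ?_⟩
  · intro v w hvw
    by_cases hv : (v : ℕ) = 0
    · have : b v = 0 := by simp only [hbdef, if_pos hv]
      omega
    · have hvw' : (v : ℕ) ≤ w := hvw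
      have hw : (w : ℕ) ≠ 0 := by omega
      rw [hbne v hv, hbne w hw]
      exact Nat.add_le_add_left (min_le_min_right _
        (Nat.div_le_div_right (Nat.sub_le_sub_right hvw' 1))) 1
  · intro v hv
    have hv0 : (v : ℕ) ≠ 0 := fun h => hv (by rw [show v = 0 from Fin.ext h])
    set c := min (((v : ℕ) - 1) / m) (q - 1) with hc
    have hcq : (c + 1) * m ≤ q * m := Nat.mul_le_mul_right _ (by omega)
    have hlt : ∀ r : Fin m, 1 + c * m + r < k + 3 := by
      intro r
      have := r.2
      rw [add_one_mul] at hcq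
      omega
    calc m = (Finset.univ.image fun r : Fin m => (⟨1 + c * m + r, hlt r⟩ : Fin (k + 3))).card := by
          rw [Finset.card_image_of_injective]
          · simp
          · intro r r' h
            have := congrArg Fin.val h
            simp only at this
            exact Fin.ext (by omega)
      _ ≤ _ := by
          refine Finset.card_le_card fun w hw => ?_
          obtain ⟨r, -, rfl⟩ := Finset.mem_image.1 hw
          refine Finset.mem_filter.2 ⟨Finset.mem_univ _, ?_⟩
          rw [hbne v hv0, hbne _ (by simp only; omega), ← hc]
          have : (1 + c * m + (r : ℕ) - 1) / m = c := by
            rw [show 1 + c * m + (r : ℕ) - 1 = r + c * m by omega,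
              Nat.add_mul_div_right _ _ hm, Nat.div_eq_of_lt r.2, zero_add]
          simp only [this]
          omega
  · intro v
    by_cases hv0 : (v : ℕ) = 0
    · obtain rfl : v = 0 := Fin.ext hv0
      calc _ ≤ ({0} : Finset (Fin (k + 3))).card := by
            refine Finset.card_le_card fun w hw => ?_
            simpa using hzero w (Finset.mem_filter.1 hw).2
        _ ≤ 2 * m := by simp; omega
    · set c := min (((v : ℕ) - 1) / m) (q - 1) with hc
      calc _ = ((Finset.univ.filter fun w => b w = b v).image Fin.val).card :=
            (Finset.card_image_of_injective _ Fin.val_injective).symm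
        _ ≤ (Finset.Ico (1 + c * m) (1 + c * m + 2 * m)).card := by
            refine Finset.card_le_card fun x hx => ?_
            obtain ⟨w, hw, rfl⟩ := Finset.mem_image.1 hx
            have hw := (Finset.mem_filter.1 hw).2
            have hw0 : (w : ℕ) ≠ 0 := by
              intro h
              rw [show w = 0 from Fin.ext h] at hw
              exact hv0 (by rw [hzero v hw.symm]; rfl)
            rw [hbne v hv0, hbne w hw0, ← hc] at hw
            have hwc : min (((w : ℕ) - 1) / m) (q - 1) = c := by omega
            have h1 : c * m ≤ (w : ℕ) - 1 :=
              (Nat.mul_le_mul_right m (hwc ▸ min_le_left _ _)).trans (Nat.div_mul_le_self _ _)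
            have h2 : (w : ℕ) - 1 < (c + 2) * m := by
              rcases le_total (((w : ℕ) - 1) / m) (q - 1) with h | h
              · rw [min_eq_left h] at hwc
                exact Nat.lt_mul_of_div_lt (by omega) hm
              · rw [min_eq_right h] at hwc
                have : c + 2 = q + 1 := by omega
                rw [this]
                have := w.2
                omega
            rw [add_mul] at h2
            rw [Finset.mem_Ico]
            omega
        _ = 2 * m := by simp

end CycleSpread

/-! ### Choice of parameters, limits and conclusion. -/

section Existence

open MeasureTheory

/-- An explicit bound on the probability that there is no Hamilton cycle with few inversions. -/
lemma binomialRandom_real_compl_hasHamiltonCycle_le {k m R L : ℕ} {M : ℝ} (p : unitInterval)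
    (hm : 0 < m) (hmk : m ≤ k + 2) (hR : 0 < R) (hL : k + 3 ≤ L * 2 ^ R)
    (hM : 2 * (m : ℝ) * (k + 3 : ℕ) ≤ M) (hp : 65 * (4 * Real.exp 1 / m) * R ≤ p) :
    (SimpleGraph.binomialRandom (Fin (k + 3)) p).real
      {G | HasHamiltonCycleWithInversionsLE G M}ᶜ ≤
      R * (1 / 16) ^ L + ((1 + 1 / (R : ℝ)) ^ L - 1) := by
  classical
  obtain ⟨b, hmono, h0, hb, hb2⟩ := exists_blocks (k := k) hm hmk
  have hlast : b (Fin.last (k + 2)) ≠ b 0 := fun h => by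
    simpa using congrArg Fin.val (h0 _ h)
  have hm' : (0 : ℝ) < m := by exact_mod_cast hm
  have hR' : (1 : ℝ) ≤ R := by exact_mod_cast hR
  set q : ℝ := 4 * Real.exp 1 / m with hq
  have hq0 : 0 < q := by have := Real.exp_pos 1; positivity
  have hqR : q ≤ q * R := le_mul_of_one_le_right hq0.le hR'
  have hp1 := p.2.2
  -- `R` halving rounds of density `64 q` and a final one of density `q R` use total density at most
  -- `65 q R ≤ p`; the final density makes `q / β = 1 / R`.
  set a : ℝ := 64 * q with ha
  set β : ℝ := q * R with hβ
  have ha1 : a ≤ 1 := by nlinarith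
  have hβ1 : β ≤ 1 := by nlinarith
  have hβ0 : 0 < β := by positivity
  have hcover := card_mul_binomialSum_not_covered_le (u := Finset.univ.filter fun e =>
    ¬ Sym2.IsDiag e) (a := a) (b := β) (q := q) (N := (blockPerms b).card) (L := L)
    (by positivity) ha1 hβ0 hβ1 hq0.le le_rfl (by positivity) R
    (blockPerms b) cycleEdges (fun σ _ => cycleEdges_subset σ)
    (fun σ _ => by rw [card_cycleEdges]; exact hL)
    (fun S => card_subset_cycleEdges_le hm h0 hb hmono hlast S)
  have hΩ : (0 : ℝ) < (blockPerms b).card := by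
    exact_mod_cast Finset.card_pos.2 ⟨1, mem_blockPerms.2 fun _ => rfl⟩
  have hqβ : q / β = 1 / R := by rw [hβ]; field_simp
  rw [hqβ] at hcover
  have hcover' := le_of_mul_le_mul_left hcover hΩ
  have hpow0 : 0 ≤ (1 - a) ^ R := pow_nonneg (by linarith) _
  have hpow1 : (1 - a) ^ R ≤ 1 := pow_le_one₀ (by linarith) (by linarith)
  have hbern : 1 - R * a ≤ (1 - a) ^ R := by
    have := one_add_mul_le_pow (a := -a) (by linarith) R
    rw [← sub_eq_add_neg] at this
    linarith
  have hpp : 1 - (1 - β) * (1 - a) ^ R ≤ p := by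
    have h1 : β * (1 - a) ^ R ≤ β := mul_le_of_le_one_right hβ0.le hpow1
    have h2 : (R : ℝ) * a + β = 65 * q * R := by rw [ha, hβ]; ring
    nlinarith
  have hp0 : 0 ≤ 1 - (1 - β) * (1 - a) ^ R := by
    have := mul_le_one₀ (by linarith : 1 - β ≤ 1) hpow0 hpow1
    linarith
  refine le_trans (le_trans ?_ (binomialSum_antitone hp0 hpp hp1 ?_)) hcover'
  · have hset : ({G : SimpleGraph (Fin (k + 3)) | HasHamiltonCycleWithInversionsLE G M})ᶜ =
        {G | ¬ ∃ σ : Equiv.Perm (Fin (k + 3)), σ 0 = 0 ∧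
          (permInversions σ : ℝ) ≤ M ∧ cycleEdges σ ⊆ G.edgeFinset} := by
      ext G
      simp only [Set.mem_compl_iff, Set.mem_ofPred_eq, hasHamiltonCycleWithInversionsLE_iff]
    rw [hset, binomialRandom_real_eq_binomialSum p (fun W => ¬ ∃ σ : Equiv.Perm (Fin (k + 3)),
      σ 0 = 0 ∧ (permInversions σ : ℝ) ≤ M ∧ cycleEdges σ ⊆ W)]
    refine binomialSum_mono p.2.1 hp1 fun W _ => ?_
    by_cases h : ∃ σ ∈ blockPerms b, cycleEdges σ ⊆ W
    · obtain ⟨σ, hσ, hσW⟩ := h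
      rw [if_neg]
      · split_ifs <;> norm_num
      · rw [not_not]
        refine ⟨σ, blockPerms_zero (k := k + 2) h0 hσ, ?_, hσW⟩
        refine le_trans ?_ hM
        have := permInversions_le_of_blockPerms hmono hb2 hσ
        calc (permInversions σ : ℝ) ≤ ((k + 3) * (2 * m) : ℕ) := by exact_mod_cast this
          _ = _ := by push_cast; ring
    · rw [if_neg h]
      split_ifs <;> norm_num
  · intro W Z hWZ
    by_cases h : ∃ σ ∈ blockPerms b, cycleEdges σ ⊆ W
    · obtain ⟨σ, hσ, hσW⟩ := h
      rw [if_pos ⟨σ, hσ, hσW.trans hWZ⟩]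
      split_ifs <;> norm_num
    · rw [if_neg h]
      split_ifs <;> norm_num

/-- The final size `L` must grow for `R * 16⁻ᴸ` to vanish, but be `o(R)` for `(1 + 1 / R) ^ L` to
tend to 1; `L = √R` meets both demands. -/
lemma failure_bound_le {R : ℕ} (hR : 0 < R) :
    (R : ℝ) * (1 / 16) ^ Nat.sqrt R + ((1 + 1 / (R : ℝ)) ^ Nat.sqrt R - 1) ≤
      (1 / 4) ^ Nat.sqrt R + (Real.exp (1 / (Nat.sqrt R : ℝ)) - 1) := by
  set L := Nat.sqrt R with hL
  have hL1 : 0 < L := Nat.sqrt_pos.2 hR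
  have hL0 : (0 : ℝ) < L := by exact_mod_cast hL1
  have hR0 : (0 : ℝ) < R := by exact_mod_cast hR
  have h1 : (R : ℝ) ≤ 4 ^ L := by
    have h2 : R < (L + 1) * (L + 1) := Nat.lt_succ_sqrt R
    have h3 : L + 1 ≤ 2 ^ L := Nat.lt_two_pow_self
    have h4 : R ≤ 4 ^ L := by
      calc R ≤ (L + 1) * (L + 1) := h2.le
        _ ≤ 2 ^ L * 2 ^ L := Nat.mul_le_mul h3 h3
        _ = 4 ^ L := by rw [← mul_pow]; norm_num
    exact_mod_cast h4
  have h5 : (L : ℝ) * L ≤ R := by exact_mod_cast Nat.sqrt_le R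
  have h6 : (1 + 1 / (R : ℝ)) ^ L ≤ Real.exp (1 / (L : ℝ)) := by
    calc (1 + 1 / (R : ℝ)) ^ L ≤ Real.exp (1 / R) ^ L := by
          refine pow_le_pow_left₀ (by positivity) ?_ _
          rw [add_comm]
          exact Real.add_one_le_exp _
      _ = Real.exp (L * (1 / R)) := (Real.exp_nat_mul _ _).symm
      _ ≤ _ := by
          rw [Real.exp_le_exp, mul_one_div, div_le_div_iff₀ hR0 hL0]
          linarith
  have h7 : (R : ℝ) * (1 / 16) ^ L ≤ (1 / 4) ^ L := by
    calc (R : ℝ) * (1 / 16) ^ L ≤ 4 ^ L * (1 / 16) ^ L := by gcongr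
      _ = (1 / 4) ^ L := by rw [← mul_pow]; norm_num
  linarith

lemma tendsto_failure_bound :
    Tendsto (fun n : ℕ => (1 / 4 : ℝ) ^ Nat.sqrt (Nat.log 2 n + 1) +
      (Real.exp (1 / (Nat.sqrt (Nat.log 2 n + 1) : ℝ)) - 1)) atTop (𝓝 0) := by
  have hL : Tendsto (fun n : ℕ => Nat.sqrt (Nat.log 2 n + 1)) atTop atTop := by
    refine tendsto_atTop.2 fun B => ?_
    filter_upwards [eventually_ge_atTop (2 ^ (B * B))] with n hn
    rw [Nat.le_sqrt]
    have := Nat.log_mono_right (b := 2) hn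
    rw [Nat.log_pow (by norm_num)] at this
    omega
  have h : Tendsto (fun L : ℕ => (1 / 4 : ℝ) ^ L + (Real.exp (1 / (L : ℝ)) - 1)) atTop (𝓝 0) := by
    have h1 : Tendsto (fun L : ℕ => (1 / 4 : ℝ) ^ L) atTop (𝓝 0) :=
      tendsto_pow_atTop_nhds_zero_of_lt_one (by norm_num) (by norm_num)
    have h2 : Tendsto (fun L : ℕ => Real.exp (1 / (L : ℝ))) atTop (𝓝 1) := by
      have := (Real.continuous_exp.tendsto 0).comp tendsto_one_div_atTop_nhds_zero_nat
      simpa [Function.comp_def] using this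
    simpa using h1.add (h2.sub_const 1)
  exact h.comp hL

lemma natLog_two_add_one_le {n : ℕ} (hn : 3 ≤ n) :
    ((Nat.log 2 n + 1 : ℕ) : ℝ) ≤ 3 * Real.log n := by
  have hlog : 1 ≤ Real.log n := by
    rw [Real.le_log_iff_exp_le (by positivity)]
    have : (3 : ℝ) ≤ n := by exact_mod_cast hn
    linarith [Real.exp_one_lt_three]
  have h1 : (Nat.log 2 n : ℝ) * Real.log 2 ≤ Real.log n := by
    rw [← Real.log_pow]
    refine Real.log_le_log (by positivity) ?_
    exact_mod_cast Nat.pow_log_le_self 2 (by omega)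
  have h2 := Real.log_two_gt_d9
  push_cast
  nlinarith [Nat.cast_nonneg (α := ℝ) (Nat.log 2 n)]

theorem tendsto_hasHamiltonCycle (M : ℕ → ℝ) {c : ℝ} (hc : 0 < c)
    (hM : ∀ᶠ n : ℕ in atTop, c * ((n : ℝ) * Real.log (n : ℝ)) ≤ M n)
    (hM2 : ∀ᶠ n : ℕ in atTop, M n ≤ (n : ℝ) ^ 2) (p : ℕ → unitInterval)
    (hp : ∀ᶠ n : ℕ in atTop, 10000 * (n : ℝ) * Real.log (n : ℝ) / M n ≤ (p n : ℝ)) :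
    Tendsto (fun n : ℕ => SimpleGraph.binomialRandom (Fin n) (p n)
      {G | HasHamiltonCycleWithInversionsLE G (M n)}) atTop (𝓝 1) := by
  refine tendsto_measure_one_of_compl_le _ _ _ tendsto_failure_bound ?_
  filter_upwards [hM, hM2, hp, eventually_ge_atTop 3] with n hM hM2 hp hn
  obtain ⟨k, rfl⟩ : ∃ k, n = k + 3 := ⟨n - 3, by omega⟩
  refine le_trans ?_ (failure_bound_le (Nat.succ_pos _))
  set n := k + 3 with hnk
  have hn0 : (0 : ℝ) < n := by positivity
  have hn3 : (3 : ℝ) ≤ n := by exact_mod_cast hn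
  have hlog : 1 ≤ Real.log n := by
    rw [Real.le_log_iff_exp_le hn0]
    linarith [Real.exp_one_lt_three]
  have hM0 : 0 < M n := lt_of_lt_of_le (by positivity) hM
  -- Since `p ≤ 1`, the lower bound on `p` itself forces `M` to be large, so the block length below
  -- is at least 1.
  have hMbig : 10000 * (n : ℝ) * Real.log n ≤ M n := by
    have := hp.trans (p n).2.2
    rwa [div_le_one hM0] at this
  set x : ℝ := M n / (2 * n) with hx
  have hx1 : 1 ≤ x := by
    rw [hx, le_div_iff₀ (by positivity)]
    nlinarith
  set m := ⌊x⌋₊ with hm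
  have hm0 : 0 < m := Nat.floor_pos.2 hx1
  have hm1 : (1 : ℝ) ≤ m := by exact_mod_cast hm0
  have hmx : (m : ℝ) ≤ x := Nat.floor_le (by linarith)
  have hxm : x ≤ 2 * m := by
    have := (Nat.lt_floor_add_one x).le
    linarith
  have hMx : M n = x * (2 * n) := by rw [hx]; field_simp
  refine binomialRandom_real_compl_hasHamiltonCycle_le (p n) hm0 ?_ (Nat.succ_pos _) ?_ ?_ ?_
  · have : (m : ℝ) ≤ (k + 2 : ℕ) := by
      refine hmx.trans ?_
      have hk : ((k + 2 : ℕ) : ℝ) = n - 1 := by rw [hnk]; push_cast; ring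
      rw [hk, hx, div_le_iff₀ (by positivity)]
      nlinarith
    exact_mod_cast this
  · calc n ≤ 2 ^ (Nat.log 2 n + 1) := (Nat.lt_pow_succ_log_self (by norm_num) n).le
      _ ≤ _ := Nat.le_mul_of_pos_left _ (Nat.sqrt_pos.2 (Nat.succ_pos _))
  · rw [hMx]
    nlinarith
  · refine le_trans ?_ hp
    have hR := natLog_two_add_one_le hn
    have hm' : (0 : ℝ) < m := by linarith
    have he := Real.exp_pos 1
    -- Here `m ≥ M / (4n)`, so the required density is at most `4 * 2340 * n * log n / M`, which the
    -- constant 10000 covers.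
    calc 65 * (4 * Real.exp 1 / m) * ((Nat.log 2 n + 1 : ℕ) : ℝ)
        ≤ 65 * (4 * 3 / m) * (3 * Real.log n) := by
          have := Real.exp_one_lt_three.le
          gcongr
      _ = 2340 * Real.log n / m := by ring
      _ ≤ 10000 * n * Real.log n / M n := by
          rw [div_le_div_iff₀ hm' hM0, hMx]
          have h1 : 0 ≤ (n : ℝ) * Real.log n := by positivity
          nlinarith [mul_le_mul_of_nonneg_left hxm h1]

end Existence

theorem theorem4 :
    ∃ K : ℝ, 0 < K ∧
      ∀ M : ℕ → ℝ,
        (∃ c : ℝ, 0 < c ∧ ∀ᶠ n : ℕ in atTop, c * ((n : ℝ) * Real.log (n : ℝ)) ≤ M n) →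
        -- the existence part
        ((∀ᶠ n : ℕ in atTop, M n ≤ (n : ℝ) ^ 2) →
          ∀ p : ℕ → unitInterval,
            (∀ᶠ n : ℕ in atTop, K * (n : ℝ) * Real.log (n : ℝ) / M n ≤ (p n : ℝ)) →
            Tendsto
              (fun n : ℕ => SimpleGraph.binomialRandom (Fin n) (p n)
                {G | HasHamiltonCycleWithInversionsLE G (M n)})
              atTop (𝓝 1)) ∧
        -- the non-existence part
        (∀ ε : ℝ, 0 < ε →
          ∀ p : ℕ → unitInterval,
            (∀ᶠ n : ℕ in atTop, (p n : ℝ) ≤ (1 - ε) * (n : ℝ) / (Real.exp 1 * M n)) →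
            Tendsto
              (fun n : ℕ => SimpleGraph.binomialRandom (Fin n) (p n)
                {G | ¬ HasHamiltonCycleWithInversionsLE G (M n)})
              atTop (𝓝 1)) := by
  refine ⟨10000, by norm_num, fun M ⟨c, hc, hM⟩ => ⟨fun hM2 p hp => ?_, fun ε hε p hp => ?_⟩⟩
  · exact tendsto_hasHamiltonCycle M hc hM hM2 p hp
  · exact tendsto_not_hasHamiltonCycle M hc hM hε p hp
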